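/- Let $p$ be a prime and let $s>-1$ be real. Write $(a;q)_n=\prod_{j=0}^{n-1}(1-aq^j)$ and $(a;q)_\infty=\prod_{j\ge 0}(1-aq^j)$. Every $\mathbf Z\in\mathrm{Mat}(N,\mathbb Q_p)$ can be written as $\mathbf Z=\mathbf B\,\mathrm{diag}(p^{-k_1},\dots,p^{-k_N})\,\mathbf C$ with $\mathbf B,\mathbf C\in \mathrm{GL}(N,\mathbb Z_p)$ and a unique tuple $k_1\ge\dots\ge k_N\ge-\infty$ in $\mathbb Z\cup\{-\infty\}$ (with $p^{\infty}=0$), the singular numbers of $\mathbf Z$; put $\gamma(\mathbf Z)=\prod_{k_j>0}p^{k_j}$. Let $\mathsf M_N^{(s)}$ be the measure on $\mathrm{Mat}(N,\mathbb Q_p)$ given by $$d\mathsf M_N^{(s)}(\mathbf Z)=\frac{(p^{-1-s};p^{-1})_N^2}{(p^{-1-s};p^{-1})_{2N}}\,\gamma(\mathbf Z)^{-s-2N}\,d\mathsf{vol}(\mathbf Z),$$ where $\mathsf{vol}$ is the Haar measure normalized by $\mathsf{vol}(\mathrm{Mat}(N,\mathbb Z_p))=1$. Then there is a unique probability measure $\mathsf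 M^{(s)}$ on the space $\mathrm{Mat}(\mathbb N,\mathbb Q_p)$ of infinite matrices whose image under $\mathbf Z\mapsto(\mathbf Z_{ij})_{i,j=1}^N$ is $\mathsf M_N^{(s)}$ for every $N\ge1$, and $$\pi^{(s)}(x)=\frac{p^{-x^2-sx}\,(p^{-1-s};p^{-1})_\infty}{(p^{-1};p^{-1})_x\,(p^{-1-s};p^{-1})_x},\qquad x\in\{0,1,2,\dots\},$$ defines a probability measure $\pi^{(s)}$ on $\{0,1,2,\dots\}$. Let $\mathbf Z$ be a random infinite matrix with law $\mathsf M^{(s)}$ and, for $i\in\mathbb Z\cup\{-\infty\}$, let $l_i^{(N)}(\mathbf Z)$ be the number of singular numbers of the corner $(\mathbf Z_{ij})_{i,j=1}^N$ that are equal to $i$. Then, as $N\to\infty$, $$\sum_{i=1}^{\infty}l_i^{(N)}(\mathbf Z)=N-\sum_{i=-\infty}^{0}l_i^{(N)}(\mathbf Z)\ \overset{\mathrm d}{\longrightarrow}\ \mathcal Z,\qquad \mathsf{Law}(\mathcal Z)=\pi^{(s)},$$ where the second sum includes $i=-\infty$. -/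

import Mathlib

open MeasureTheory ProbabilityTheory Filter

noncomputable section

namespace PadicHua

/-- The Borel σ-algebra on `ℚ_p`. -/
instance instMeasurableSpacePadic (p : ℕ) [Fact p.Prime] : MeasurableSpace ℚ_[p] := borel _

instance instBorelSpacePadic (p : ℕ) [Fact p.Prime] : BorelSpace ℚ_[p] := ⟨rfl⟩

/-- The product σ-algebra on matrices (finite or infinite). -/
instance instMeasurableSpaceMatrix (ι κ R : Type*) [MeasurableSpace R] :
    MeasurableSpace (Matrix ι κ R) :=
  inferInstanceAs (MeasurableSpace (ι → κ → R))

/-- The compact unit ball `ℤ_p` of `ℚ_p`, which has non-empty interior. -/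
def unitBall (p : ℕ) [Fact p.Prime] : TopologicalSpace.PositiveCompacts ℚ_[p] where
  carrier := Metric.closedBall 0 1
  isCompact' := isCompact_closedBall 0 1
  interior_nonempty' :=
    ⟨0, interior_mono Metric.ball_subset_closedBall (by
      rw [Metric.isOpen_ball.interior_eq]; exact Metric.mem_ball_self one_pos)⟩

/-- The Haar measure on `Mat(N, ℚ_p) = ℚ_p ^ (N²)` that gives mass one to `Mat(N, ℤ_p)`: the
product of the Haar measures on the entries, each of which gives mass one to `ℤ_p`. -/
def vol (p : ℕ) [Fact p.Prime] (N : ℕ) : Measure (Matrix (Fin N) (Fin N) ℚ_[p]) :=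
  Measure.pi fun _ : Fin N => Measure.pi fun _ : Fin N => Measure.addHaarMeasure (unitBall p)

/-- `p ^ (-k)` for `k ∈ ℤ ∪ {-∞}`, where `p ^ (-(-∞)) = 0`. -/
def padicPowNeg (p : ℕ) [Fact p.Prime] : WithBot ℤ → ℚ_[p]
  | ⊥ => 0
  | (k : ℤ) => (p : ℚ_[p]) ^ (-k)

/-- `k₁ ≥ k₂ ≥ ⋯ ≥ k_N ≥ -∞` are the singular numbers of `Z`:
`Z = B · diag(p^{-k₁}, …, p^{-k_N}) · C` with `B, C ∈ GL(N, ℤ_p)`. -/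
def IsSingularNumbers {p : ℕ} [Fact p.Prime] {N : ℕ} (Z : Matrix (Fin N) (Fin N) ℚ_[p])
    (k : Fin N → WithBot ℤ) : Prop :=
  Antitone k ∧ ∃ B C : GL (Fin N) ℤ_[p],
    Z = (B : Matrix (Fin N) (Fin N) ℤ_[p]).map (fun x => (x : ℚ_[p])) *
      Matrix.diagonal (fun j => padicPowNeg p (k j)) *
      (C : Matrix (Fin N) (Fin N) ℤ_[p]).map (fun x => (x : ℚ_[p]))

/-- The `N`-tuple of singular numbers of `Z`, i.e. the (unique) `k` such that
`IsSingularNumbers Z k`. -/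
def sing {p : ℕ} [Fact p.Prime] {N : ℕ} (Z : Matrix (Fin N) (Fin N) ℚ_[p]) :
    Fin N → WithBot ℤ :=
  Classical.epsilon (IsSingularNumbers Z)

/-- `γ(Z) = ∏_{k_j > 0} p^{k_j}`, where `k₁, …, k_N` are the singular numbers of `Z`. -/
def gam {p : ℕ} [Fact p.Prime] {N : ℕ} (Z : Matrix (Fin N) (Fin N) ℚ_[p]) : ℝ :=
  ∏ j with 0 < sing Z j, (p : ℝ) ^ ((sing Z j).unbotD 0)

/-- The `q`-Pochhammer symbol `(a; q)_n = ∏_{j=0}^{n-1} (1 - a q^j)`. -/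
def qPoch (a q : ℝ) (n : ℕ) : ℝ := ∏ j ∈ Finset.range n, (1 - a * q ^ j)

/-- `(a; q)_∞ = ∏_{j=0}^∞ (1 - a q^j)`, used only for `0 < q < 1`. -/
def qPochInf (a q : ℝ) : ℝ := ∏' j : ℕ, (1 - a * q ^ j)

/-- The `p`-adic Hua measure `M_N^{(s)}` on `Mat(N, ℚ_p)`, with density
`(p^{-1-s}; p^{-1})_N² / (p^{-1-s}; p^{-1})_{2N} · γ(Z)^{-s-2N}` with respect to `vol`. -/
def huaFin (p : ℕ) [Fact p.Prime] (s : ℝ) (N : ℕ) : Measure (Matrix (Fin N) (Fin N) ℚ_[p]) :=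
  (vol p N).withDensity fun Z => ENNReal.ofReal
    (qPoch ((p : ℝ) ^ (-1 - s)) (p : ℝ)⁻¹ N ^ 2 / qPoch ((p : ℝ) ^ (-1 - s)) (p : ℝ)⁻¹ (2 * N) *
      gam Z ^ (-s - 2 * (N : ℝ)))

/-- The top left `N × N` corner of an infinite matrix. -/
def corner {p : ℕ} [Fact p.Prime] (N : ℕ) (Z : Matrix ℕ ℕ ℚ_[p]) :
    Matrix (Fin N) (Fin N) ℚ_[p] :=
  Z.submatrix Fin.val Fin.val

/-- `M` is a probability measure on `Mat(ℕ, ℚ_p)` whose image under the corner map to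
`Mat(N, ℚ_p)` is the `p`-adic Hua measure `M_N^{(s)}`, for all `N ≥ 1`. -/
structure IsHuaMeasure (p : ℕ) [Fact p.Prime] (s : ℝ) (M : Measure (Matrix ℕ ℕ ℚ_[p])) :
    Prop where
  isProbabilityMeasure : IsProbabilityMeasure M
  map_corner : ∀ N : ℕ, 1 ≤ N → M.map (corner N) = huaFin p s N

/-- The `p`-adic Hua measure `M^{(s)}` on infinite matrices: the unique probability measure on
`Mat(ℕ, ℚ_p)` all of whose corners are distributed as `M_N^{(s)}`. -/
def hua (p : ℕ) [Fact p.Prime] (s : ℝ) : Measure (Matrix ℕ ℕ ℚ_[p]) :=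
  Classical.epsilon (IsHuaMeasure p s)

/-- `l_i^{(N)}(Z)`: the number of singular numbers of the `N × N` corner of `Z` equal to `i`,
for `i ∈ ℤ ∪ {-∞}`. -/
def ell {p : ℕ} [Fact p.Prime] (N : ℕ) (Z : Matrix ℕ ℕ ℚ_[p]) (i : WithBot ℤ) : ℕ :=
  Finset.card {j : Fin N | sing (corner N Z) j = i}

/-- `∑_{i=1}^∞ l_i^{(N)}(Z)`: the number of positive singular numbers of the `N × N` corner. -/
def sumPos {p : ℕ} [Fact p.Prime] (N : ℕ) (Z : Matrix ℕ ℕ ℚ_[p]) : ℕ :=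
  ∑ᶠ (i : ℤ) (_ : 1 ≤ i), ell N Z (i : WithBot ℤ)

/-- `∑_{i=-∞}^0 l_i^{(N)}(Z)`; the value `i = -∞` is included. -/
def sumNonpos {p : ℕ} [Fact p.Prime] (N : ℕ) (Z : Matrix ℕ ℕ ℚ_[p]) : ℕ :=
  ∑ᶠ (i : WithBot ℤ) (_ : i ≤ 0), ell N Z i

/-- The weight `π^{(s)}(x)`. -/
def piWeight (p : ℕ) (s : ℝ) (x : ℕ) : ℝ :=
  (p : ℝ) ^ (-(x : ℝ) ^ 2 - s * x) * qPochInf ((p : ℝ) ^ (-1 - s)) (p : ℝ)⁻¹ /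
    (qPoch (p : ℝ)⁻¹ (p : ℝ)⁻¹ x * qPoch ((p : ℝ) ^ (-1 - s)) (p : ℝ)⁻¹ x)

/-- The measure `π^{(s)}` on `{0, 1, 2, …}` with mass `π^{(s)}(x)` at `x`. -/
def piMeasure (p : ℕ) (s : ℝ) : Measure ℕ :=
  Measure.sum fun x : ℕ => ENNReal.ofReal (piWeight p s x) • Measure.dirac x

end PadicHua

end

/-! Everything is read off from the lattice `L(Z)` generated by `ℤ_p ^ m` and the rows of `Z`. In
Smith form its volume is the product of the `max 1 ‖d_j‖`, so `γ(Z) = vol L(Z)` (`gam_eq_latVol`).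
Replacing `Z` by `p Z` lowers each positive exponent by one, so `vol L(Z) / vol L(pZ)` is `p` to the
number of positive singular numbers, called the rank below (`latVol_div`, `posRank_eq_card`).

Choose linear coordinates in which `L(Z)` becomes `ℤ_p ^ m`. Appending a row with coordinate vector
`w` multiplies the volume by `max 1 ‖w‖`. It raises the rank by one exactly when `‖w‖ > 1` and no
coordinate with positive exponent attains the maximum (`Adapted.posRank_insRow`). Hence integrating
`γ ^ (-t)` over the new row gives `γ(Z) ^ (1 - t)` times a "stay" mass and an "up" mass that depend
on `Z` only through its rank (`lintegral_insRow`).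

This is used twice. If the rank is forgotten, the two masses add up to a constant independent of
`Z`. Integrating out a row and then, since `γ` is invariant under transposition, a column turns `γ ^
(-t)` into a multiple of `γ ^ (2 - t)` (`lintegral_dropLast`). The constants match the
normalization, so the finite Hua measures are consistent and, starting from size zero, have mass
one; a projective limit gives the infinite measure. If the rank is kept, the masses of the rank
classes satisfy a two-term recursion in the number of rows, solved in closed form by `rankMass`
(`lintegral_posRank`).

The resulting rank probabilities converge pointwise to `π^{(s)}` and are dominated by a geometric
sequence of ratio `p ^ (-1 - s) < 1`. Dominated convergence yields both the total mass of `π^{(s)}`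
and the convergence in law. -/

open scoped ENNReal NNReal Topology

noncomputable section

namespace PadicHua

/-! ### Haar measure of balls and boxes. -/

section

variable {p : ℕ} [hp : Fact p.Prime]

/-- The Haar measure on `ℚ_p` giving mass one to `ℤ_p`. -/
abbrev haarQ (p : ℕ) [Fact p.Prime] : Measure ℚ_[p] := Measure.addHaarMeasure (unitBall p)

/-- The Haar measure on `ℚ_p ^ ι` giving mass one to `ℤ_p ^ ι`. -/
abbrev haarPi (p : ℕ) [Fact p.Prime] (ι : Type*) [Fintype ι] : Measure (ι → ℚ_[p]) :=
  Measure.pi fun _ => haarQ p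

lemma one_lt_p : (1 : ℝ) < p := by exact_mod_cast hp.out.one_lt

lemma p_pos : (0 : ℝ) < p := by exact_mod_cast hp.out.pos

lemma norm_p_zpow (e : ℤ) : ‖(p : ℚ_[p]) ^ e‖ = (p : ℝ) ^ (-e) := by
  rw [norm_zpow, Padic.norm_p, inv_zpow, zpow_neg]

lemma haarQ_closedBall_one : haarQ p (Metric.closedBall 0 1) = 1 :=
  Measure.addHaarMeasure_self (K₀ := unitBall p)

lemma exists_digit (x : ℚ_[p]) (hx : ‖x‖ ≤ 1) :
    ∃ i ∈ Finset.range p, ‖x - (i : ℚ_[p])‖ < 1 := by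
  obtain ⟨n, hn, h⟩ := PadicInt.exists_mem_range (p := p) (⟨x, hx⟩ : ℤ_[p])
  refine ⟨n, by simpa using hn, ?_⟩
  have := PadicInt.mem_nonunits.1 ((IsLocalRing.mem_maximalIdeal _).1 h)
  exact this

lemma norm_natCast_sub_eq_one {i j : ℕ} (hi : i < p) (hj : j < p) (hij : i ≠ j) :
    ‖(i : ℚ_[p]) - j‖ = 1 := by
  have h1 : ‖(((i : ℤ) - (j : ℤ) : ℤ) : ℚ_[p])‖ ≤ 1 := Padic.norm_int_le_one _
  have h2 : ¬ ‖(((i : ℤ) - (j : ℤ) : ℤ) : ℚ_[p])‖ < 1 := by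
    rw [Padic.norm_intCast_lt_one_iff]
    intro h
    have := Int.eq_zero_of_abs_lt_dvd h (by rw [abs_lt]; constructor <;> omega)
    omega
  push_cast at h1 h2
  exact le_antisymm h1 (not_lt.1 h2)

lemma haarQ_closedBall_succ (e : ℤ) :
    haarQ p (Metric.closedBall 0 ((p : ℝ) ^ (e + 1))) =
      p * haarQ p (Metric.closedBall 0 ((p : ℝ) ^ e)) := by
  have hp0 : (p : ℚ_[p]) ≠ 0 := by exact_mod_cast hp.out.ne_zero
  have hpe (k : ℤ) : (0 : ℝ) < (p : ℝ) ^ k := zpow_pos p_pos _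
  -- The larger ball is a disjoint union of `p` translates of the smaller one, indexed by the
  -- leading digit `i`.
  have key : Metric.closedBall (0 : ℚ_[p]) ((p : ℝ) ^ (e + 1)) =
      ⋃ i ∈ Finset.range p, (fun x => ((i : ℚ_[p]) * (p : ℚ_[p]) ^ (-(e + 1))) + x) ''
        Metric.closedBall 0 ((p : ℝ) ^ e) := by
    ext x
    simp only [Set.mem_iUnion, Set.mem_image, mem_closedBall_zero_iff, exists_prop]
    constructor
    · intro hx
      have : ‖x * (p : ℚ_[p]) ^ (e + 1)‖ ≤ 1 := by
        rw [norm_mul, norm_p_zpow, zpow_neg]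
        exact mul_inv_le_one_of_le₀ hx (hpe _).le
      obtain ⟨i, hi, h⟩ := exists_digit _ this
      refine ⟨i, hi, x - (i : ℚ_[p]) * (p : ℚ_[p]) ^ (-(e + 1)), ?_, by ring⟩
      have h2 : x - (i : ℚ_[p]) * (p : ℚ_[p]) ^ (-(e + 1)) =
          (x * (p : ℚ_[p]) ^ (e + 1) - i) * (p : ℚ_[p]) ^ (-(e + 1)) := by
        rw [sub_mul, mul_assoc, ← zpow_add₀ hp0]; simp
      rw [Padic.norm_le_pow_iff_norm_lt_pow_add_one, h2, norm_mul, norm_p_zpow, neg_neg]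
      exact (mul_lt_mul_of_pos_right h (hpe _)).trans_eq (one_mul _)
    · rintro ⟨i, hi, y, hy, rfl⟩
      refine (IsUltrametricDist.norm_add_le_max _ _).trans (max_le ?_ ?_)
      · rw [norm_mul, norm_p_zpow, neg_neg]
        refine mul_le_of_le_one_left (hpe _).le ?_
        exact_mod_cast Padic.norm_int_le_one (i : ℤ)
      · exact hy.trans (zpow_le_zpow_right₀ one_lt_p.le (by omega))
  rw [key, measure_biUnion_finset]
  · simp only [Set.image_add_left, measure_preimage_add, Finset.sum_const, Finset.card_range,
      nsmul_eq_mul]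
  · intro i hi j hj hij
    simp only [Finset.coe_range, Set.mem_Iio] at hi hj
    rw [Function.onFun, Set.disjoint_left]
    rintro _ ⟨x, hx, rfl⟩ ⟨y, hy, hxy⟩
    simp only [mem_closedBall_zero_iff] at hx hy hxy
    have h1 : ((i : ℚ_[p]) - j) * (p : ℚ_[p]) ^ (-(e + 1)) = y - x := by linear_combination -hxy
    have h2 : ‖y - x‖ ≤ (p : ℝ) ^ e := by
      rw [sub_eq_add_neg]
      exact (IsUltrametricDist.norm_add_le_max _ _).trans (max_le hy (by simpa using hx))
    rw [← h1, norm_mul, norm_natCast_sub_eq_one hi hj hij, norm_p_zpow, one_mul, neg_neg] at h2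
    exact absurd h2 (not_le.2 (zpow_lt_zpow_right₀ one_lt_p (by omega)))
  · intro i _
    rw [Set.image_add_left]
    exact (measurable_const_add _) Metric.isClosed_closedBall.measurableSet

lemma haarQ_closedBall (e : ℤ) :
    haarQ p (Metric.closedBall 0 ((p : ℝ) ^ e)) = (p : ℝ≥0∞) ^ e := by
  have hp0 : (p : ℝ≥0∞) ≠ 0 := by exact_mod_cast hp.out.ne_zero
  have hpt : (p : ℝ≥0∞) ≠ ∞ := ENNReal.natCast_ne_top p
  induction e with
  | zero => simpa using haarQ_closedBall_one (p := p)
  | succ k ih =>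
    rw [haarQ_closedBall_succ, ih, ENNReal.zpow_add hp0 hpt, zpow_one, mul_comm]
  | pred k ih =>
    have := haarQ_closedBall_succ (p := p) (-(k : ℤ) - 1)
    rw [sub_add_cancel, ih] at this
    rw [ENNReal.zpow_sub hp0 hpt, this, zpow_one, mul_comm, ← mul_assoc,
      ENNReal.inv_mul_cancel hp0 hpt, one_mul]

variable {ι κ : Type*} [Fintype ι] [Fintype κ]

lemma haarPi_box (e : ι → ℤ) :
    haarPi p ι {v | ∀ j, ‖v j‖ ≤ (p : ℝ) ^ e j} = (p : ℝ≥0∞) ^ (∑ j, e j) := by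
  have hp0 : (p : ℝ≥0∞) ≠ 0 := by exact_mod_cast hp.out.ne_zero
  have hpt : (p : ℝ≥0∞) ≠ ∞ := ENNReal.natCast_ne_top p
  have : {v : ι → ℚ_[p] | ∀ j, ‖v j‖ ≤ (p : ℝ) ^ e j} =
      Set.pi Set.univ fun j => Metric.closedBall 0 ((p : ℝ) ^ e j) := by
    ext v; simp
  rw [this, Measure.pi_pi]
  simp_rw [haarQ_closedBall]
  induction (Finset.univ : Finset ι) using Finset.cons_induction with
  | empty => simp
  | cons a s ha ih => rw [Finset.prod_cons, Finset.sum_cons, ENNReal.zpow_add hp0 hpt, ih]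

lemma measurableSet_box (r : ι → ℝ) : MeasurableSet {v : ι → ℚ_[p] | ∀ j, ‖v j‖ ≤ r j} := by
  have : {v : ι → ℚ_[p] | ∀ j, ‖v j‖ ≤ r j} = ⋂ j, {v | ‖v j‖ ≤ r j} := by ext; simp
  rw [this]
  exact MeasurableSet.iInter fun j => measurableSet_le (by fun_prop) (by fun_prop)

lemma haarPi_unitBox : haarPi p ι {v | ∀ j, ‖v j‖ ≤ 1} = 1 := by
  simpa using haarPi_box (p := p) (ι := ι) 0

/-- A Haar measure is determined by its value on a set that a second Haar measure gives mass one. -/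
lemma addHaar_eq_smul {G : Type*} [AddCommGroup G] [TopologicalSpace G] [IsTopologicalAddGroup G]
    [MeasurableSpace G] [BorelSpace G] [LocallyCompactSpace G] [SecondCountableTopology G]
    (μ ν : Measure G) [μ.IsAddHaarMeasure] [ν.IsAddHaarMeasure] (s : Set G) (hs : ν s = 1) :
    μ = μ s • ν := by
  have h := Measure.isAddLeftInvariant_eq_smul μ ν
  have h1 : μ s = (μ.addHaarScalarFactor ν : ℝ≥0∞) := by
    conv_lhs => rw [h]
    simp [hs]
  rw [h1]; exact h

/-- The image measure is again a Haar measure, so it is enough to compare masses on the unit box.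
This replaces a determinant formula for the change of variables. -/
lemma map_linearEquiv_haarPi (φ : (ι → ℚ_[p]) ≃ₗ[ℚ_[p]] (ι → ℚ_[p])) :
    (haarPi p ι).map φ = haarPi p ι {v | ∀ j, ‖φ v j‖ ≤ 1} • haarPi p ι := by
  let φ' : (ι → ℚ_[p]) ≃L[ℚ_[p]] (ι → ℚ_[p]) := φ.toContinuousLinearEquiv
  have hφ : Measurable φ := φ'.continuous.measurable
  have : ((haarPi p ι).map φ).IsAddHaarMeasure := φ'.isAddHaarMeasure_map _
  rw [addHaar_eq_smul ((haarPi p ι).map φ) (haarPi p ι) _ haarPi_unitBox,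
    Measure.map_apply hφ (measurableSet_box _)]
  rfl

end

/-! ### Smith normal form for rectangular matrices. -/

section

variable {p : ℕ} [hp : Fact p.Prime]

/-- A matrix over `ℤ_p` viewed over `ℚ_p`. -/
def toQ {ι κ : Type*} (M : Matrix ι κ ℤ_[p]) : Matrix ι κ ℚ_[p] := M.map fun x => (x : ℚ_[p])

section toQ

variable {ι κ μ : Type*}

lemma toQ_mul [Fintype κ] (A : Matrix ι κ ℤ_[p]) (B : Matrix κ μ ℤ_[p]) : toQ (A * B) = toQ A * toQ B := by
  ext i j
  simp [toQ, Matrix.mul_apply]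

lemma toQ_one [DecidableEq κ] : toQ (1 : Matrix κ κ ℤ_[p]) = 1 := by
  ext i j
  by_cases h : i = j <;> simp [toQ, Matrix.one_apply, h]

lemma norm_toQ_le (A : Matrix ι κ ℤ_[p]) (i : ι) (j : κ) : ‖toQ A i j‖ ≤ 1 := (A i j).2

lemma toQ_mul_inv [Fintype κ] [DecidableEq κ] (U : GL κ ℤ_[p]) :
    toQ (U : Matrix κ κ ℤ_[p]) * toQ ((U⁻¹ : GL κ ℤ_[p]) : Matrix κ κ ℤ_[p]) = 1 := by
  rw [← toQ_mul, Units.mul_inv, toQ_one]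

lemma toQ_inv_mul [Fintype κ] [DecidableEq κ] (U : GL κ ℤ_[p]) :
    toQ ((U⁻¹ : GL κ ℤ_[p]) : Matrix κ κ ℤ_[p]) * toQ (U : Matrix κ κ ℤ_[p]) = 1 := by
  rw [← toQ_mul, Units.inv_mul, toQ_one]

end toQ

/-- Equivalence of `p`-adic matrices under left and right multiplication by `GL(ℤ_p)`. -/
def SmithEquiv {ι κ : Type*} [Fintype ι] [DecidableEq ι] [Fintype κ] [DecidableEq κ]
    (Z W : Matrix ι κ ℚ_[p]) : Prop :=
  ∃ (B : GL ι ℤ_[p]) (C : GL κ ℤ_[p]),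
    Z = toQ (B : Matrix ι ι ℤ_[p]) * W * toQ (C : Matrix κ κ ℤ_[p])

section SmithEquiv

variable {ι κ : Type*} [Fintype ι] [DecidableEq ι] [Fintype κ] [DecidableEq κ]

lemma SmithEquiv.refl (Z : Matrix ι κ ℚ_[p]) : SmithEquiv Z Z :=
  ⟨1, 1, by simp [toQ_one]⟩

lemma SmithEquiv.trans {X Y Z : Matrix ι κ ℚ_[p]} (h₁ : SmithEquiv X Y) (h₂ : SmithEquiv Y Z) :
    SmithEquiv X Z := by
  obtain ⟨B, C, rfl⟩ := h₁
  obtain ⟨B', C', rfl⟩ := h₂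
  refine ⟨B * B', C' * C, ?_⟩
  simp [toQ_mul, Matrix.mul_assoc]

lemma SmithEquiv.symm {X Y : Matrix ι κ ℚ_[p]} (h : SmithEquiv X Y) : SmithEquiv Y X := by
  obtain ⟨B, C, rfl⟩ := h
  refine ⟨B⁻¹, C⁻¹, ?_⟩
  rw [Matrix.mul_assoc, Matrix.mul_assoc, Matrix.mul_assoc, toQ_mul_inv, Matrix.mul_one,
    ← Matrix.mul_assoc, toQ_inv_mul, Matrix.one_mul]

/-- The permutation matrix of `σ` as an element of `GL(ℤ_p)`. -/
def permGL (σ : Equiv.Perm ι) : GL ι ℤ_[p] where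
  val := σ.permMatrix ℤ_[p]
  inv := σ⁻¹.permMatrix ℤ_[p]
  val_inv := by rw [← Matrix.permMatrix_mul]; simp
  inv_val := by rw [← Matrix.permMatrix_mul]; simp

lemma toQ_permGL (σ : Equiv.Perm ι) :
    toQ (permGL (p := p) σ : Matrix ι ι ℤ_[p]) = σ.permMatrix ℚ_[p] := by
  ext i j
  by_cases h : σ i = j <;> simp [permGL, toQ, PEquiv.toMatrix_apply, h]

lemma smithEquiv_submatrix (Z : Matrix ι κ ℚ_[p]) (σ : Equiv.Perm ι) (τ : Equiv.Perm κ) :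
    SmithEquiv (Z.submatrix σ τ) Z := by
  refine ⟨permGL σ, permGL τ⁻¹, ?_⟩
  rw [toQ_permGL, toQ_permGL]
  ext i j
  simp [PEquiv.toMatrix_toPEquiv_mul, PEquiv.mul_toMatrix_toPEquiv, Equiv.Perm.inv_def]

/-- The matrix `1 + c e_kᵀ` with `c k = 0`. -/
def colGL (k : ι) (c : ι → ℤ_[p]) (hc : c k = 0) : GL ι ℤ_[p] where
  val := 1 + Matrix.vecMulVec c (Pi.single k 1)
  inv := 1 - Matrix.vecMulVec c (Pi.single k 1)
  val_inv := by
    rw [add_mul, mul_sub, mul_sub, Matrix.vecMulVec_mul_vecMulVec]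
    simp [hc]
  inv_val := by
    rw [sub_mul, mul_add, mul_add, Matrix.vecMulVec_mul_vecMulVec]
    simp [hc]

/-- The matrix `1 + e_k rᵀ` with `r k = 0`. -/
def rowGL (k : ι) (r : ι → ℤ_[p]) (hr : r k = 0) : GL ι ℤ_[p] where
  val := 1 + Matrix.vecMulVec (Pi.single k 1) r
  inv := 1 - Matrix.vecMulVec (Pi.single k 1) r
  val_inv := by
    rw [add_mul, mul_sub, mul_sub, Matrix.vecMulVec_mul_vecMulVec]
    simp [hr]
  inv_val := by
    rw [sub_mul, mul_add, mul_add, Matrix.vecMulVec_mul_vecMulVec]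
    simp [hr]

end SmithEquiv

lemma toQ_colGL_mul_apply {ι κ : Type*} [Fintype ι] [DecidableEq ι] (k : ι) (c : ι → ℤ_[p]) (hc : c k = 0) (W : Matrix ι κ ℚ_[p])
    (i : ι) (j : κ) :
    (toQ (colGL k c hc : Matrix ι ι ℤ_[p]) * W) i j = W i j + c i * W k j := by
  have : toQ (colGL k c hc : Matrix ι ι ℤ_[p]) =
      1 + Matrix.vecMulVec (fun i => (c i : ℚ_[p])) (Pi.single k 1) := by
    ext i j
    simp only [toQ, colGL, Matrix.map_apply, Matrix.add_apply, Matrix.vecMulVec_apply,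
      Matrix.one_apply, Pi.single_apply]
    split_ifs <;> simp
  rw [this, Matrix.add_mul, Matrix.one_mul, Matrix.add_apply, Matrix.vecMulVec_mul]
  simp [Matrix.vecMulVec_apply]

lemma mul_toQ_rowGL_apply {ι κ : Type*} [Fintype κ] [DecidableEq κ] (k : κ) (r : κ → ℤ_[p]) (hr : r k = 0) (W : Matrix ι κ ℚ_[p])
    (i : ι) (j : κ) :
    (W * toQ (rowGL k r hr : Matrix κ κ ℤ_[p])) i j = W i j + W i k * r j := by
  have : toQ (rowGL k r hr : Matrix κ κ ℤ_[p]) =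
      1 + Matrix.vecMulVec (Pi.single k 1) (fun i => (r i : ℚ_[p])) := by
    ext i j
    simp only [toQ, rowGL, Matrix.map_apply, Matrix.add_apply, Matrix.vecMulVec_apply,
      Matrix.one_apply, Pi.single_apply]
    split_ifs <;> simp
  rw [this, Matrix.mul_add, Matrix.mul_one, Matrix.add_apply, Matrix.mul_vecMulVec]
  simp [Matrix.vecMulVec_apply]

/-- The block diagonal matrix with blocks `x` and `A`. -/
def bord {R : Type*} [Zero R] {n m : ℕ} (x : R) (A : Matrix (Fin n) (Fin m) R) :
    Matrix (Fin (n + 1)) (Fin (m + 1)) R :=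
  Matrix.of fun i j => Fin.cases (Fin.cases x (fun _ => 0) j)
    (fun i' => Fin.cases 0 (fun j' => A i' j') j) i

section bord

variable {R : Type*} {n m l : ℕ}

@[simp] lemma bord_zero_zero [Zero R] (x : R) (A : Matrix (Fin n) (Fin m) R) :
    bord x A 0 0 = x := rfl
@[simp] lemma bord_zero_succ [Zero R] (x : R) (A : Matrix (Fin n) (Fin m) R) (j : Fin m) :
    bord x A 0 j.succ = 0 := rfl
@[simp] lemma bord_succ_zero [Zero R] (x : R) (A : Matrix (Fin n) (Fin m) R) (i : Fin n) :
    bord x A i.succ 0 = 0 := rfl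
@[simp] lemma bord_succ_succ [Zero R] (x : R) (A : Matrix (Fin n) (Fin m) R) (i : Fin n)
    (j : Fin m) : bord x A i.succ j.succ = A i j := rfl

lemma bord_mul [NonUnitalNonAssocSemiring R] (x y : R) (A : Matrix (Fin n) (Fin m) R)
    (B : Matrix (Fin m) (Fin l) R) : bord x A * bord y B = bord (x * y) (A * B) := by
  ext i j
  refine Fin.cases ?_ (fun i => ?_) i <;> refine Fin.cases ?_ (fun j => ?_) j <;>
    simp [Matrix.mul_apply, Fin.sum_univ_succ]

lemma bord_one_one [Zero R] [One R] : bord (1 : R) (1 : Matrix (Fin n) (Fin n) R) = 1 := by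
  ext i j
  refine Fin.cases ?_ (fun i => ?_) i <;> refine Fin.cases ?_ (fun j => ?_) j <;>
    simp [Matrix.one_apply, Fin.succ_ne_zero, (Fin.succ_ne_zero _).symm]

/-- The block diagonal extension of an element of `GL(n, ℤ_p)` by one. -/
def bordGL (U : GL (Fin n) ℤ_[p]) : GL (Fin (n + 1)) ℤ_[p] where
  val := bord 1 (U : Matrix (Fin n) (Fin n) ℤ_[p])
  inv := bord 1 ((U⁻¹ : GL (Fin n) ℤ_[p]) : Matrix (Fin n) (Fin n) ℤ_[p])
  val_inv := by rw [bord_mul, Units.mul_inv, one_mul, bord_one_one]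
  inv_val := by rw [bord_mul, Units.inv_mul, one_mul, bord_one_one]

lemma toQ_bordGL (U : GL (Fin n) ℤ_[p]) :
    toQ (bordGL U : Matrix (Fin (n + 1)) (Fin (n + 1)) ℤ_[p]) =
      bord 1 (toQ (U : Matrix (Fin n) (Fin n) ℤ_[p])) := by
  ext i j
  refine Fin.cases ?_ (fun i => ?_) i <;> refine Fin.cases ?_ (fun j => ?_) j <;>
    simp [toQ, bordGL]

lemma SmithEquiv.bord {A B : Matrix (Fin n) (Fin m) ℚ_[p]} (h : SmithEquiv A B) (x : ℚ_[p]) :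
    SmithEquiv (bord x A) (bord x B) := by
  obtain ⟨U, V, rfl⟩ := h
  refine ⟨bordGL U, bordGL V, ?_⟩
  rw [toQ_bordGL, toQ_bordGL, bord_mul, bord_mul, one_mul, mul_one]

/-- The rectangular diagonal matrix with diagonal entries `d 0, d 1, …`. -/
def rdiag {R : Type*} [Zero R] (n m : ℕ) (d : ℕ → R) : Matrix (Fin n) (Fin m) R :=
  Matrix.of fun i j => if (i : ℕ) = j then d i else 0

lemma bord_rdiag [Zero R] (x : R) (d : ℕ → R) :
    bord x (rdiag n m d) = rdiag (n + 1) (m + 1) (fun i => Nat.casesOn i x d) := by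
  ext i j
  refine Fin.cases ?_ (fun i => ?_) i <;> refine Fin.cases ?_ (fun j => ?_) j <;>
    simp [rdiag]

end bord

/-- A matrix whose top left entry has maximal norm is equivalent to a block diagonal one. -/
lemma smithEquiv_bord_of_max {n m : ℕ} (Z : Matrix (Fin (n + 1)) (Fin (m + 1)) ℚ_[p])
    (h0 : Z 0 0 ≠ 0) (hmax : ∀ i j, ‖Z i j‖ ≤ ‖Z 0 0‖) :
    ∃ w : Matrix (Fin n) (Fin m) ℚ_[p], SmithEquiv Z (bord (Z 0 0) w) := by
  have hle (i j) : ‖Z i j / Z 0 0‖ ≤ 1 := by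
    rw [norm_div]; exact div_le_one_of_le₀ (hmax i j) (norm_nonneg _)
  let c : Fin (n + 1) → ℤ_[p] := fun i => if i = 0 then 0 else ⟨Z i 0 / Z 0 0, hle i 0⟩
  let r : Fin (m + 1) → ℤ_[p] := fun j => if j = 0 then 0 else ⟨Z 0 j / Z 0 0, hle 0 j⟩
  refine ⟨Matrix.of fun i j => Z i.succ j.succ - Z i.succ 0 * Z 0 j.succ / Z 0 0,
    colGL 0 c (by simp [c]), rowGL 0 r (by simp [r]), ?_⟩
  ext i j
  rw [mul_toQ_rowGL_apply, toQ_colGL_mul_apply, toQ_colGL_mul_apply]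
  refine Fin.cases ?_ (fun i => ?_) i <;> refine Fin.cases ?_ (fun j => ?_) j <;>
    simp [c, r] <;> field_simp
  ring

/-- Gaussian elimination: a pivot of maximal norm is swapped into the corner, so the multipliers
that clear its row and column lie in `ℤ_p`; induction handles the remaining block. -/
theorem exists_smithEquiv_rdiag (n m : ℕ) (Z : Matrix (Fin n) (Fin m) ℚ_[p]) :
    ∃ d : ℕ → ℚ_[p], SmithEquiv Z (rdiag n m d) := by
  induction n generalizing m with
  | zero => exact ⟨0, by convert SmithEquiv.refl Z; ext i; exact i.elim0⟩
  | succ n ih =>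
    cases m with
    | zero => exact ⟨0, by convert SmithEquiv.refl Z; ext i j; exact j.elim0⟩
    | succ m =>
      by_cases hZ : Z = 0
      · refine ⟨0, ?_⟩
        convert SmithEquiv.refl Z
        ext i j
        simp [rdiag, hZ]
      obtain ⟨⟨i₀, j₀⟩, hmax⟩ := Finite.exists_max fun ij : Fin (n + 1) × Fin (m + 1) =>
        ‖Z ij.1 ij.2‖
      have h0 : Z i₀ j₀ ≠ 0 := by
        intro h
        apply hZ
        ext i j
        simpa [h] using hmax (i, j)
      have h1 := smithEquiv_submatrix Z (Equiv.swap 0 i₀) (Equiv.swap 0 j₀)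
      obtain ⟨w, hw⟩ := smithEquiv_bord_of_max (Z.submatrix (Equiv.swap 0 i₀) (Equiv.swap 0 j₀))
        (by simpa using h0) (fun i j => by simpa using hmax (_, _))
      obtain ⟨d, hd⟩ := ih m w
      refine ⟨fun i => Nat.casesOn i (Z i₀ j₀) d, h1.symm.trans (hw.trans ?_)⟩
      rw [← bord_rdiag]
      simpa using hd.bord (Z i₀ j₀)

end

/-! ### The row lattice and coordinates adapted to it. -/

section

variable {p : ℕ} [hp : Fact p.Prime]

section IntVec

variable {ι κ : Type*}

/-- Vectors with entries in `ℤ_p`. -/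
def IntVec (x : ι → ℚ_[p]) : Prop := ∀ i, ‖x i‖ ≤ 1

lemma norm_add_le_of_le {x y : ℚ_[p]} {r : ℝ} (hx : ‖x‖ ≤ r) (hy : ‖y‖ ≤ r) : ‖x + y‖ ≤ r :=
  (IsUltrametricDist.norm_add_le_max _ _).trans (max_le hx hy)

lemma norm_sub_le_of_le {x y : ℚ_[p]} {r : ℝ} (hx : ‖x‖ ≤ r) (hy : ‖y‖ ≤ r) : ‖x - y‖ ≤ r := by
  rw [sub_eq_add_neg]
  exact norm_add_le_of_le hx (by rwa [norm_neg])

lemma IntVec.sub {x y : ι → ℚ_[p]} (hx : IntVec x) (hy : IntVec y) : IntVec (x - y) :=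
  fun i => norm_sub_le_of_le (hx i) (hy i)

lemma norm_vecMul_le [Fintype ι] {r s : ℝ} (hr : 0 ≤ r) (hs : 0 ≤ s) {x : ι → ℚ_[p]}
    (hx : ∀ i, ‖x i‖ ≤ r) {A : Matrix ι κ ℚ_[p]} (hA : ∀ i j, ‖A i j‖ ≤ s) (j : κ) :
    ‖(Matrix.vecMul x A) j‖ ≤ r * s := by
  refine IsUltrametricDist.norm_sum_le_of_forall_le_of_nonneg (by positivity) fun i _ => ?_
  rw [norm_mul]
  exact mul_le_mul (hx i) (hA i j) (norm_nonneg _) hr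

lemma IntVec.vecMul [Fintype ι] {x : ι → ℚ_[p]} (hx : IntVec x) {A : Matrix ι κ ℚ_[p]}
    (hA : ∀ i j, ‖A i j‖ ≤ 1) : IntVec (Matrix.vecMul x A) := fun j => by
  simpa using norm_vecMul_le zero_le_one zero_le_one hx hA j

lemma norm_mul_apply_le {μ : Type*} [Fintype κ] {r s : ℝ} (hr : 0 ≤ r) (hs : 0 ≤ s)
    {A : Matrix ι κ ℚ_[p]} (hA : ∀ i j, ‖A i j‖ ≤ r) {B : Matrix κ μ ℚ_[p]}
    (hB : ∀ i j, ‖B i j‖ ≤ s) (i : ι) (j : μ) : ‖(A * B) i j‖ ≤ r * s :=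
  norm_vecMul_le hr hs (hA i) hB j

/-- Integral factors cannot increase the largest entry, by the ultrametric inequality. Together with
`SmithEquiv.symm` this makes the maximal norm an invariant. -/
lemma SmithEquiv.norm_le [Fintype ι] [DecidableEq ι] [Fintype κ] [DecidableEq κ]
    {Z W : Matrix ι κ ℚ_[p]} (h : SmithEquiv Z W) {r : ℝ} (hr : 0 ≤ r)
    (hW : ∀ i j, ‖W i j‖ ≤ r) (i : ι) (j : κ) : ‖Z i j‖ ≤ r := by
  obtain ⟨B, C, rfl⟩ := h
  have h1 := norm_mul_apply_le zero_le_one hr (norm_toQ_le (B : Matrix ι ι ℤ_[p])) hW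
  rw [one_mul] at h1
  simpa using norm_mul_apply_le hr zero_le_one h1 (norm_toQ_le (C : Matrix κ κ ℤ_[p])) i j

end IntVec

section rowLattice

variable {ι κ : Type*} [Fintype ι]

/-- The `ℤ_p`-lattice generated by `ℤ_p ^ κ` and the rows of `Z`. -/
def rowLattice (Z : Matrix ι κ ℚ_[p]) : Set (κ → ℚ_[p]) :=
  {y | ∃ x : ι → ℚ_[p], IntVec x ∧ IntVec (y - Matrix.vecMul x Z)}

lemma rowLattice_add_subset (Z X : Matrix ι κ ℚ_[p]) (hX : ∀ i j, ‖X i j‖ ≤ 1) :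
    rowLattice Z ⊆ rowLattice (Z + X) := by
  rintro y ⟨x, hx, hy⟩
  refine ⟨x, hx, ?_⟩
  rw [Matrix.vecMul_add, ← sub_sub]
  exact hy.sub (hx.vecMul hX)

lemma rowLattice_add (Z X : Matrix ι κ ℚ_[p]) (hX : ∀ i j, ‖X i j‖ ≤ 1) :
    rowLattice (Z + X) = rowLattice Z := by
  refine (rowLattice_add_subset Z X hX).antisymm' ?_
  simpa using rowLattice_add_subset (Z + X) (-X) (by simpa using hX)

/-- The left factor only permutes the integral coefficient vectors, while the right factor preserves
integral vectors, so the lattice changes by the right factor alone. -/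
lemma mem_rowLattice_of_smith [DecidableEq ι] [Fintype κ] [DecidableEq κ] (B : GL ι ℤ_[p])
    (W : Matrix ι κ ℚ_[p]) (C : GL κ ℤ_[p]) (y : κ → ℚ_[p]) :
    y ∈ rowLattice (toQ (B : Matrix ι ι ℤ_[p]) * W * toQ (C : Matrix κ κ ℤ_[p])) ↔
      Matrix.vecMul y (toQ ((C⁻¹ : GL κ ℤ_[p]) : Matrix κ κ ℤ_[p])) ∈ rowLattice W := by
  constructor
  · rintro ⟨x, hx, hy⟩
    refine ⟨_, hx.vecMul (norm_toQ_le (B : Matrix ι ι ℤ_[p])), ?_⟩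
    have := hy.vecMul (norm_toQ_le ((C⁻¹ : GL κ ℤ_[p]) : Matrix κ κ ℤ_[p]))
    rwa [Matrix.sub_vecMul, Matrix.vecMul_vecMul, Matrix.mul_assoc, toQ_mul_inv, Matrix.mul_one,
      ← Matrix.vecMul_vecMul] at this
  · rintro ⟨x, hx, hy⟩
    refine ⟨_, hx.vecMul (norm_toQ_le ((B⁻¹ : GL ι ℤ_[p]) : Matrix ι ι ℤ_[p])), ?_⟩
    have := hy.vecMul (norm_toQ_le (C : Matrix κ κ ℤ_[p]))
    rw [Matrix.sub_vecMul, Matrix.vecMul_vecMul, toQ_inv_mul, Matrix.vecMul_one] at this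
    rwa [Matrix.vecMul_vecMul, ← Matrix.mul_assoc, ← Matrix.mul_assoc, toQ_inv_mul, Matrix.one_mul,
      ← Matrix.vecMul_vecMul]

end rowLattice

section rdiag

variable {n m : ℕ}

lemma vecMul_rdiag (x : Fin n → ℚ_[p]) (d : ℕ → ℚ_[p]) (j : Fin m) :
    Matrix.vecMul x (rdiag n m d) j = if h : (j : ℕ) < n then x ⟨j, h⟩ * d j else 0 := by
  simp only [Matrix.vecMul, dotProduct, rdiag, Matrix.of_apply, mul_ite, mul_zero]
  split_ifs with h
  · rw [Finset.sum_eq_single ⟨j, h⟩] <;> simp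
    intro b hb h'
    exact absurd (Fin.ext h') hb
  · refine Finset.sum_eq_zero fun i _ => if_neg ?_
    omega

lemma mem_rowLattice_rdiag (d : ℕ → ℚ_[p]) (y : Fin m → ℚ_[p]) :
    y ∈ rowLattice (rdiag n m d) ↔
      ∀ j, ‖y j‖ ≤ max 1 ‖if (j : ℕ) < n then d j else 0‖ := by
  constructor
  · rintro ⟨x, hx, hy⟩ j
    have h1 := hy j
    rw [Pi.sub_apply, vecMul_rdiag] at h1
    split_ifs at h1 ⊢ with h
    · have h2 : ‖x ⟨j, h⟩ * d j‖ ≤ max 1 ‖d j‖ := by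
        rw [norm_mul]
        exact (mul_le_of_le_one_left (norm_nonneg _) (hx _)).trans (le_max_right _ _)
      simpa using norm_add_le_of_le (h1.trans (le_max_left _ _)) h2
    · simpa using h1
  -- A coefficient is needed only where `d` has norm larger than one; elsewhere `y` is already
  -- integral and the coefficient zero works.
  · intro hy
    refine ⟨fun i => if h : (i : ℕ) < m ∧ 1 < ‖d i‖ then y ⟨i, h.1⟩ / d i else 0, fun i => ?_,
      fun j => ?_⟩
    · dsimp only
      split_ifs with h
      · have := hy ⟨i, h.1⟩
        simp only [Fin.is_lt, if_true] at this
        rw [max_eq_right h.2.le] at this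
        rw [norm_div]
        exact div_le_one_of_le₀ this (norm_nonneg _)
      · simp
    · have := hy j
      rw [Pi.sub_apply, vecMul_rdiag]
      split_ifs at this ⊢ with h h'
      · have h0 : d j ≠ 0 := by
          intro h0
          have := h'.2
          simp [h0] at this
          linarith
        simp [h0]
      · have : ‖d j‖ ≤ 1 := by
          by_contra hc
          exact h' ⟨j.2, not_le.1 hc⟩
        simpa [this, h] using hy j
      · simpa using this

/-- The exponent `e` with `max 1 ‖x‖ = p ^ e`. -/
def posExp (x : ℚ_[p]) : ℕ := (-x.valuation).toNat

lemma max_one_norm (x : ℚ_[p]) : max 1 ‖x‖ = (p : ℝ) ^ posExp x := by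
  have hp1 := one_lt_p (p := p)
  by_cases hx : x = 0
  · simp [hx, posExp]
  rw [Padic.norm_eq_zpow_neg_valuation hx, posExp]
  rcases le_or_gt 0 x.valuation with h | h
  · rw [Int.toNat_of_nonpos (by omega), pow_zero]
    exact max_eq_left (zpow_le_one_of_nonpos₀ hp1.le (by omega))
  · rw [← zpow_natCast, Int.toNat_of_nonneg (by omega)]
    exact max_eq_right (one_le_zpow₀ hp1.le (by omega))

lemma posExp_p_mul (x : ℚ_[p]) : posExp ((p : ℚ_[p]) * x) = posExp x - 1 := by
  by_cases hx : x = 0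
  · simp [hx, posExp]
  have hp0 : (p : ℚ_[p]) ≠ 0 := by exact_mod_cast hp.out.ne_zero
  rw [posExp, posExp, Padic.valuation_mul hp0 hx, Padic.valuation_p]
  omega

/-- `C` and `e` describe the lattices generated by `ℤ_p ^ m` and the rows of `Z`, respectively
of `p Z`. -/
structure Adapted (Z : Matrix (Fin n) (Fin m) ℚ_[p]) (C : GL (Fin m) ℤ_[p]) (e : Fin m → ℕ) :
    Prop where
  mem_iff : ∀ y, y ∈ rowLattice Z ↔
    ∀ j, ‖Matrix.vecMul y (toQ (C : Matrix (Fin m) (Fin m) ℤ_[p])) j‖ ≤ (p : ℝ) ^ e j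
  mem_smul_iff : ∀ y, y ∈ rowLattice ((p : ℚ_[p]) • Z) ↔
    ∀ j, ‖Matrix.vecMul y (toQ (C : Matrix (Fin m) (Fin m) ℤ_[p])) j‖ ≤ (p : ℝ) ^ (e j - 1)

lemma smul_rdiag (c : ℚ_[p]) (d : ℕ → ℚ_[p]) : c • rdiag n m d = rdiag n m (fun i => c * d i) := by
  ext i j
  simp [rdiag]

lemma adapted_of_smith (B : GL (Fin n) ℤ_[p]) (C : GL (Fin m) ℤ_[p]) (d : ℕ → ℚ_[p]) :
    Adapted (toQ (B : Matrix (Fin n) (Fin n) ℤ_[p]) * rdiag n m d *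
      toQ (C : Matrix (Fin m) (Fin m) ℤ_[p])) C⁻¹
      (fun j => posExp (if (j : ℕ) < n then d j else 0)) where
  mem_iff y := by
    rw [mem_rowLattice_of_smith, mem_rowLattice_rdiag]
    simp_rw [max_one_norm]
  mem_smul_iff y := by
    rw [← Matrix.smul_mul, ← Matrix.mul_smul, mem_rowLattice_of_smith, smul_rdiag,
      mem_rowLattice_rdiag]
    simp_rw [max_one_norm, ← posExp_p_mul, mul_ite, mul_zero]

lemma exists_adapted (Z : Matrix (Fin n) (Fin m) ℚ_[p]) : ∃ C e, Adapted Z C e := by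
  obtain ⟨d, B, C, rfl⟩ := exists_smithEquiv_rdiag n m Z
  exact ⟨_, _, adapted_of_smith B C d⟩

end rdiag

section adaptedEquiv

variable {κ : Type*} [Fintype κ] [DecidableEq κ]

/-- Coordinates on `ℚ_p ^ κ` in which the lattice with parameters `C` and `e` is `ℤ_p ^ κ`. -/
def latticeCoord (C : GL κ ℤ_[p]) (e : κ → ℕ) : (κ → ℚ_[p]) ≃ₗ[ℚ_[p]] (κ → ℚ_[p]) where
  toFun y := fun j => Matrix.vecMul y (toQ (C : Matrix κ κ ℤ_[p])) j * (p : ℚ_[p]) ^ e j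
  invFun w := Matrix.vecMul (fun j => w j * ((p : ℚ_[p]) ^ e j)⁻¹)
    (toQ ((C⁻¹ : GL κ ℤ_[p]) : Matrix κ κ ℤ_[p]))
  map_add' x y := by ext j; simp [Matrix.add_vecMul, add_mul]
  map_smul' c y := by ext j; simp [Matrix.smul_vecMul, mul_assoc]
  left_inv y := by
    have hp0 : (p : ℚ_[p]) ≠ 0 := by exact_mod_cast hp.out.ne_zero
    simp only [mul_assoc, mul_inv_cancel₀ (pow_ne_zero _ hp0), mul_one]
    rw [Matrix.vecMul_vecMul, toQ_mul_inv, Matrix.vecMul_one]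
  right_inv y := by
    have hp0 : (p : ℚ_[p]) ≠ 0 := by exact_mod_cast hp.out.ne_zero
    simp only [Matrix.vecMul_vecMul, toQ_inv_mul, Matrix.vecMul_one, mul_assoc,
      inv_mul_cancel₀ (pow_ne_zero _ hp0), mul_one]

lemma latticeCoord_apply (C : GL κ ℤ_[p]) (e : κ → ℕ) (y : κ → ℚ_[p]) (j : κ) :
    latticeCoord C e y j = Matrix.vecMul y (toQ (C : Matrix κ κ ℤ_[p])) j * (p : ℚ_[p]) ^ e j :=
  rfl

lemma norm_latticeCoord_le_one_iff (C : GL κ ℤ_[p]) (e : κ → ℕ) (y : κ → ℚ_[p]) (j : κ) :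
    ‖latticeCoord C e y j‖ ≤ 1 ↔
      ‖Matrix.vecMul y (toQ (C : Matrix κ κ ℤ_[p])) j‖ ≤ (p : ℝ) ^ e j := by
  rw [latticeCoord_apply, norm_mul, norm_pow, Padic.norm_p, inv_pow, ← div_eq_mul_inv,
    div_le_one (pow_pos p_pos _)]

lemma measurable_latticeCoord (C : GL κ ℤ_[p]) (e : κ → ℕ) : Measurable (latticeCoord C e) :=
  (latticeCoord C e).toContinuousLinearEquiv.continuous.measurable

lemma haarPi_lattice (C : GL κ ℤ_[p]) (e : κ → ℕ) :
    haarPi p κ {y | ∀ j, ‖latticeCoord C e y j‖ ≤ 1} = (p : ℝ≥0∞) ^ ∑ j, e j := by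
  -- With zero exponents the map is multiplication by an element of `GL(ℤ_p)`. It preserves the unit
  -- box, hence the measure, and the lattice is its preimage of a box with sides `p ^ e j`.
  have h0 : {y | ∀ j, ‖latticeCoord C 0 y j‖ ≤ 1} = {y : κ → ℚ_[p] | ∀ j, ‖y j‖ ≤ 1} := by
    ext y
    simp only [Set.mem_ofPred_eq, norm_latticeCoord_le_one_iff, Pi.zero_apply, pow_zero]
    refine ⟨fun h => ?_, fun h => ?_⟩
    · have := IntVec.vecMul h (norm_toQ_le ((C⁻¹ : GL κ ℤ_[p]) : Matrix κ κ ℤ_[p]))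
      rwa [Matrix.vecMul_vecMul, toQ_mul_inv, Matrix.vecMul_one] at this
    · exact IntVec.vecMul h (norm_toQ_le (C : Matrix κ κ ℤ_[p]))
  have h1 := map_linearEquiv_haarPi (latticeCoord (p := p) C 0)
  rw [h0, haarPi_unitBox, one_smul] at h1
  have h2 : {y | ∀ j, ‖latticeCoord C e y j‖ ≤ 1} =
      latticeCoord C 0 ⁻¹' {w | ∀ j, ‖w j‖ ≤ (p : ℝ) ^ ((e j : ℕ) : ℤ)} := by
    ext y
    simp only [Set.mem_ofPred_eq, norm_latticeCoord_le_one_iff, Set.mem_preimage, zpow_natCast]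
    simp [latticeCoord_apply]
  rw [h2, ← Measure.map_apply (measurable_latticeCoord C 0) (measurableSet_box _), h1, haarPi_box,
    ← Nat.cast_sum, zpow_natCast]

lemma map_latticeCoord (C : GL κ ℤ_[p]) (e : κ → ℕ) :
    (haarPi p κ).map (latticeCoord C e) = (p : ℝ≥0∞) ^ (∑ j, e j) • haarPi p κ := by
  rw [map_linearEquiv_haarPi, haarPi_lattice]

end adaptedEquiv

end

/-! ### Lattice volume, rank, and the effect of inserting a row. -/

section

variable {p : ℕ} [hp : Fact p.Prime] {n m : ℕ}

/-- The volume of the lattice generated by `ℤ_p ^ m` and the rows of `Z`. -/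
def latVol (Z : Matrix (Fin n) (Fin m) ℚ_[p]) : ℝ := (haarPi p (Fin m)).real (rowLattice Z)

/-- The number of positive singular numbers, read off from lattice volumes. -/
def posRank (Z : Matrix (Fin n) (Fin m) ℚ_[p]) : ℕ :=
  Nat.log p ⌊latVol Z / latVol ((p : ℚ_[p]) • Z)⌋₊

namespace Adapted

variable {Z : Matrix (Fin n) (Fin m) ℚ_[p]} {C : GL (Fin m) ℤ_[p]} {e : Fin m → ℕ}

lemma mem_iff_coord (h : Adapted Z C e) (y : Fin m → ℚ_[p]) :
    y ∈ rowLattice Z ↔ IntVec (latticeCoord C e y) := by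
  rw [h.mem_iff]
  exact forall_congr' fun j => (norm_latticeCoord_le_one_iff C e y j).symm

lemma mem_smul_iff_coord (h : Adapted Z C e) (y : Fin m → ℚ_[p]) :
    y ∈ rowLattice ((p : ℚ_[p]) • Z) ↔ IntVec (latticeCoord C (fun j => e j - 1) y) := by
  rw [h.mem_smul_iff]
  exact forall_congr' fun j => (norm_latticeCoord_le_one_iff C (fun j => e j - 1) y j).symm

lemma latVol_eq (h : Adapted Z C e) : latVol Z = (p : ℝ) ^ ∑ j, e j := by
  have : rowLattice Z = {y | ∀ j, ‖latticeCoord C e y j‖ ≤ 1} := Set.ext h.mem_iff_coord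
  rw [latVol, this, Measure.real, haarPi_lattice]
  simp

lemma latVol_smul_eq (h : Adapted Z C e) :
    latVol ((p : ℚ_[p]) • Z) = (p : ℝ) ^ ∑ j, (e j - 1) := by
  have : rowLattice ((p : ℚ_[p]) • Z) = {y | ∀ j, ‖latticeCoord C (fun j => e j - 1) y j‖ ≤ 1} :=
    Set.ext h.mem_smul_iff_coord
  rw [latVol, this, Measure.real, haarPi_lattice]
  simp

/-- The difference `e j - (e j - 1)` is one for positive `e j` and zero otherwise, because the
subtraction is truncated. -/
lemma latVol_div (h : Adapted Z C e) :
    latVol Z / latVol ((p : ℚ_[p]) • Z) = (p : ℝ) ^ (Finset.univ.filter fun j => 0 < e j).card := by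
  rw [h.latVol_eq, h.latVol_smul_eq, div_eq_iff (pow_pos p_pos _).ne', ← pow_add,
    Finset.card_filter, ← Finset.sum_add_distrib]
  congr 1
  refine Finset.sum_congr rfl fun j _ => ?_
  split_ifs <;> omega

lemma posRank_eq (h : Adapted Z C e) :
    posRank Z = (Finset.univ.filter fun j => 0 < e j).card := by
  rw [posRank, h.latVol_div]
  have : ((p : ℝ) ^ (Finset.univ.filter fun j => 0 < e j).card) =
    ((p ^ (Finset.univ.filter fun j => 0 < e j).card : ℕ) : ℝ) := by push_cast; rfl
  rw [this, Nat.floor_natCast, Nat.log_pow hp.out.one_lt]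

end Adapted

lemma latVol_pos (Z : Matrix (Fin n) (Fin m) ℚ_[p]) : 0 < latVol Z := by
  obtain ⟨C, e, h⟩ := exists_adapted Z
  rw [h.latVol_eq]
  exact pow_pos p_pos _

lemma latVol_div_eq (Z : Matrix (Fin n) (Fin m) ℚ_[p]) :
    latVol Z / latVol ((p : ℚ_[p]) • Z) = (p : ℝ) ^ posRank Z := by
  obtain ⟨C, e, h⟩ := exists_adapted Z
  rw [h.latVol_div, h.posRank_eq]

lemma posRank_eq_of_latVol {Z : Matrix (Fin n) (Fin m) ℚ_[p]} {r : ℕ}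
    (h : latVol Z = (p : ℝ) ^ r * latVol ((p : ℚ_[p]) • Z)) : posRank Z = r := by
  have h1 := latVol_div_eq Z
  rw [h, mul_div_assoc, div_self (latVol_pos _).ne', mul_one] at h1
  exact (pow_right_injective₀ p_pos one_lt_p.ne' h1).symm

lemma latVol_add (Z X : Matrix (Fin n) (Fin m) ℚ_[p]) (hX : ∀ i j, ‖X i j‖ ≤ 1) :
    latVol (Z + X) = latVol Z := by
  rw [latVol, rowLattice_add Z X hX, latVol]

lemma posRank_add (Z X : Matrix (Fin n) (Fin m) ℚ_[p]) (hX : ∀ i j, ‖X i j‖ ≤ 1) :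
    posRank (Z + X) = posRank Z := by
  rw [posRank, posRank, latVol_add Z X hX, smul_add, latVol_add]
  intro i j
  rw [Matrix.smul_apply, smul_eq_mul, norm_mul]
  exact mul_le_one₀ (by rw [Padic.norm_p]; exact inv_le_one_of_one_le₀ one_lt_p.le)
    (norm_nonneg _) (hX i j)

lemma latVol_of_smith {Z : Matrix (Fin n) (Fin m) ℚ_[p]} {d : ℕ → ℚ_[p]}
    (h : SmithEquiv Z (rdiag n m d)) :
    latVol Z = ∏ j ∈ Finset.range m with j < n, max 1 ‖d j‖ := by
  obtain ⟨B, C, rfl⟩ := h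
  rw [(adapted_of_smith B C d).latVol_eq, ← Finset.prod_pow_eq_pow_sum]
  simp_rw [← max_one_norm]
  rw [Finset.prod_filter, Finset.prod_range]
  refine Finset.prod_congr rfl fun j _ => ?_
  split_ifs <;> simp

/-- The transpose of an element of `GL(ℤ_p)`. -/
def transposeGL {ι : Type*} [Fintype ι] [DecidableEq ι] (U : GL ι ℤ_[p]) : GL ι ℤ_[p] where
  val := (U : Matrix ι ι ℤ_[p]).transpose
  inv := ((U⁻¹ : GL ι ℤ_[p]) : Matrix ι ι ℤ_[p]).transpose
  val_inv := by rw [← Matrix.transpose_mul, Units.inv_mul, Matrix.transpose_one]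
  inv_val := by rw [← Matrix.transpose_mul, Units.mul_inv, Matrix.transpose_one]

lemma SmithEquiv.transpose {ι κ : Type*} [Fintype ι] [DecidableEq ι] [Fintype κ] [DecidableEq κ]
    {Z W : Matrix ι κ ℚ_[p]} (h : SmithEquiv Z W) : SmithEquiv Z.transpose W.transpose := by
  obtain ⟨B, C, rfl⟩ := h
  refine ⟨transposeGL C, transposeGL B, ?_⟩
  rw [Matrix.transpose_mul, Matrix.transpose_mul, ← Matrix.mul_assoc]
  rfl

/-- Transposition keeps the diagonal of the Smith form, and the product in `latVol_of_smith` runs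
over `j < min n m`. This symmetry lets columns be treated as rows. -/
lemma latVol_transpose (Z : Matrix (Fin n) (Fin m) ℚ_[p]) : latVol Z.transpose = latVol Z := by
  obtain ⟨d, h⟩ := exists_smithEquiv_rdiag n m Z
  have h' := h.transpose
  have : (rdiag n m d).transpose = rdiag m n d := by
    ext i j
    simp only [rdiag, Matrix.transpose_apply, Matrix.of_apply, eq_comm (a := (j : ℕ))]
    split_ifs with hij
    · rw [hij]
    · rfl
  rw [this] at h'
  rw [latVol_of_smith h, latVol_of_smith h']
  refine Finset.prod_congr ?_ fun _ _ => rfl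
  ext j
  simp [and_comm]

section insert

/-- The lattice generated by `ℤ_p ^ m` and one vector. -/
lemma haarPi_lattice_single (w : Fin m → ℚ_[p]) :
    (haarPi p (Fin m)).real {y | ∃ c : ℚ_[p], ‖c‖ ≤ 1 ∧ IntVec (y - c • w)} = max 1 ‖w‖ := by
  have hL : {y | ∃ c : ℚ_[p], ‖c‖ ≤ 1 ∧ IntVec (y - c • w)} =
      rowLattice (Matrix.of fun _ : Fin 1 => w) := by
    ext y
    have hx (x : Fin 1 → ℚ_[p]) : Matrix.vecMul x (Matrix.of fun _ : Fin 1 => w) = x 0 • w := by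
      ext j
      simp [Matrix.vecMul, dotProduct]
    constructor
    · rintro ⟨c, hc, h⟩
      exact ⟨fun _ => c, fun _ => hc, by rwa [hx]⟩
    · rintro ⟨x, h, h'⟩
      exact ⟨x 0, h 0, by rwa [← hx]⟩
  obtain ⟨d, hd⟩ := exists_smithEquiv_rdiag 1 m (Matrix.of fun _ : Fin 1 => w)
  rw [hL]
  change latVol _ = _
  rw [latVol_of_smith hd]
  cases m with
  | zero =>
    have : w = 0 := Subsingleton.elim _ _
    rw [this, norm_zero]
    simp
  | succ m =>
    have : (Finset.range (m + 1)).filter (fun j => j < 1) = {0} := by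
      ext j
      simp only [Finset.mem_filter, Finset.mem_range, Finset.mem_singleton]
      omega
    rw [this, Finset.prod_singleton]
    congr 1
    -- The Smith form of a single row has one entry, whose norm is the maximal norm of the row.
    refine le_antisymm ?_ ?_
    · have := hd.symm.norm_le (norm_nonneg w) (fun _ j => norm_le_pi_norm w j) 0 0
      simpa [rdiag] using this
    · refine (pi_norm_le_iff_of_nonneg (norm_nonneg _)).2 fun j => ?_
      refine hd.norm_le (norm_nonneg _) (fun i j => ?_) 0 j
      simp only [rdiag, Matrix.of_apply]
      split_ifs
      · simp
      · simp

/-- Insert the row `v` into `Z` at position `i`. -/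
def insRow (i : Fin (n + 1)) (v : Fin m → ℚ_[p]) (Z : Matrix (Fin n) (Fin m) ℚ_[p]) :
    Matrix (Fin (n + 1)) (Fin m) ℚ_[p] :=
  i.insertNth (α := fun _ => Fin m → ℚ_[p]) v Z

@[simp] lemma insRow_same (i : Fin (n + 1)) (v : Fin m → ℚ_[p]) (Z : Matrix (Fin n) (Fin m) ℚ_[p])
    (j : Fin m) : insRow i v Z i j = v j :=
  congrFun (Fin.insertNth_apply_same (α := fun _ => Fin m → ℚ_[p]) i v Z) j

@[simp] lemma insRow_succAbove (i : Fin (n + 1)) (v : Fin m → ℚ_[p])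
    (Z : Matrix (Fin n) (Fin m) ℚ_[p]) (k : Fin n) (j : Fin m) :
    insRow i v Z (i.succAbove k) j = Z k j :=
  congrFun (Fin.insertNth_apply_succAbove (α := fun _ => Fin m → ℚ_[p]) i v Z k) j

lemma mem_rowLattice_insRow (i : Fin (n + 1)) (v : Fin m → ℚ_[p])
    (Z : Matrix (Fin n) (Fin m) ℚ_[p]) (y : Fin m → ℚ_[p]) :
    y ∈ rowLattice (insRow i v Z) ↔
      ∃ c : ℚ_[p], ‖c‖ ≤ 1 ∧ y - c • v ∈ rowLattice Z := by
  have hv (x : Fin (n + 1) → ℚ_[p]) :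
      Matrix.vecMul x (insRow i v Z) =
        x i • v + Matrix.vecMul (i.removeNth x) Z := by
    ext j
    simp [Matrix.vecMul, dotProduct, Fin.sum_univ_succAbove _ i, Fin.removeNth]
  constructor
  · rintro ⟨x, hx, h⟩
    refine ⟨x i, hx i, i.removeNth x, fun k => hx _, ?_⟩
    rwa [hv, ← sub_sub] at h
  · rintro ⟨c, hc, x, hx, h⟩
    refine ⟨i.insertNth c x, ?_, ?_⟩
    · intro k
      refine Fin.succAboveCases i ?_ (fun k => ?_) k
      · simpa using hc
      · simpa using hx k
    · rw [hv, ← sub_sub]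
      simpa using h

lemma haarPi_real_coord_preimage (C : GL (Fin m) ℤ_[p]) (e : Fin m → ℕ) (w : Fin m → ℚ_[p]) :
    (haarPi p (Fin m)).real
      {y | ∃ c : ℚ_[p], ‖c‖ ≤ 1 ∧ IntVec (latticeCoord C e y - c • latticeCoord C e w)} =
    (p : ℝ) ^ (∑ j, e j) * max 1 ‖latticeCoord C e w‖ := by
  let φ := (latticeCoord (p := p) C e).toContinuousLinearEquiv.toHomeomorph.toMeasurableEquiv
  have h : (haarPi p (Fin m)).map φ = (p : ℝ≥0∞) ^ (∑ j, e j) • haarPi p (Fin m) :=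
    map_latticeCoord C e
  have h2 := φ.map_apply (μ := haarPi p (Fin m))
    {y | ∃ c : ℚ_[p], ‖c‖ ≤ 1 ∧ IntVec (y - c • latticeCoord C e w)}
  rw [h] at h2
  have h3 := congrArg ENNReal.toReal h2
  rw [Measure.smul_apply, smul_eq_mul, ENNReal.toReal_mul, ← Measure.real,
    haarPi_lattice_single] at h3
  simp only [ENNReal.toReal_pow, ENNReal.toReal_natCast] at h3
  rw [h3]
  rfl

/-- In adapted coordinates the old lattice is the standard one, so the new lattice is generated by
`ℤ_p ^ m` and one vector. -/
lemma Adapted.latVol_insRow {Z : Matrix (Fin n) (Fin m) ℚ_[p]} {C : GL (Fin m) ℤ_[p]}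
    {e : Fin m → ℕ} (h : Adapted Z C e) (i : Fin (n + 1)) (v : Fin m → ℚ_[p]) :
    latVol (insRow i v Z) =
      latVol Z * max 1 ‖latticeCoord C e v‖ := by
  rw [h.latVol_eq, ← haarPi_real_coord_preimage]
  refine congrArg (haarPi p (Fin m)).real ?_
  ext y
  rw [mem_rowLattice_insRow]
  simp_rw [h.mem_iff_coord, map_sub, map_smul]
  rfl

lemma Adapted.latVol_smul_insRow {Z : Matrix (Fin n) (Fin m) ℚ_[p]} {C : GL (Fin m) ℤ_[p]}
    {e : Fin m → ℕ} (h : Adapted Z C e) (i : Fin (n + 1)) (v : Fin m → ℚ_[p]) :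
    latVol ((p : ℚ_[p]) • (insRow i v Z)) = latVol ((p : ℚ_[p]) • Z) *
        max 1 ‖fun j => if 0 < e j then latticeCoord C e v j else p * latticeCoord C e v j‖ := by
  have h1 : (p : ℚ_[p]) • (insRow i v Z) =
      insRow i ((p : ℚ_[p]) • v) ((p : ℚ_[p]) • Z) := by
    ext k j
    refine Fin.succAboveCases i ?_ (fun k => ?_) k <;> simp
  -- For `p Z` the exponents are `e j - 1`. The factor `p` from the scaled row makes up for the
  -- lowered exponent when `e j > 0`, and survives when `e j = 0`.
  have h2 : (fun j => if 0 < e j then latticeCoord C e v j else p * latticeCoord C e v j) =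
      latticeCoord C (fun j => e j - 1) ((p : ℚ_[p]) • v) := by
    ext j
    simp only [latticeCoord_apply, Matrix.smul_vecMul, Pi.smul_apply, smul_eq_mul]
    split_ifs with hj
    · obtain ⟨k, hk⟩ := Nat.exists_eq_succ_of_ne_zero hj.ne'
      simp only [hk, Nat.succ_eq_add_one, Nat.add_sub_cancel]
      ring
    · have : e j = 0 := by omega
      simp [this]
  rw [h1, h2, h.latVol_smul_eq, ← haarPi_real_coord_preimage]
  refine congrArg (haarPi p (Fin m)).real ?_
  ext y
  rw [mem_rowLattice_insRow]
  simp_rw [h.mem_smul_iff_coord, map_sub, map_smul]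
  rfl

end insert

end

/-! ### Integration over one additional row. -/

section

variable {p : ℕ} [hp : Fact p.Prime] {n m : ℕ}

/-- Vectors of norm larger than one whose coordinates in `S` all have smaller norm. -/
def offRegion (S : Finset (Fin m)) : Set (Fin m → ℚ_[p]) :=
  {w | 1 < ‖w‖ ∧ ∀ j ∈ S, ‖w j‖ < ‖w‖}

/-- The part of `offRegion S` where the norm is `p ^ (k + 1)`. -/
def offShell (S : Finset (Fin m)) (k : ℕ) : Set (Fin m → ℚ_[p]) :=
  {w | ∀ j, ‖w j‖ ≤ (p : ℝ) ^ (if j ∈ S then (k : ℤ) else k + 1)} \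
    {w | ∀ j, ‖w j‖ ≤ (p : ℝ) ^ (k : ℤ)}

lemma exists_norm_eq_of_one_lt {w : Fin m → ℚ_[p]} (hw : 1 < ‖w‖) :
    ∃ (k : ℕ) (j : Fin m), ‖w‖ = (p : ℝ) ^ (k + 1) ∧ ‖w j‖ = ‖w‖ := by
  have hm : Nonempty (Fin m) := by
    by_contra h
    rw [not_nonempty_iff] at h
    rw [Subsingleton.elim w 0, norm_zero] at hw
    linarith
  obtain ⟨j, hj⟩ := Finite.exists_max fun j => ‖w j‖
  have h1 : ‖w j‖ = ‖w‖ :=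
    le_antisymm (norm_le_pi_norm w j) ((pi_norm_le_iff_of_nonneg (norm_nonneg _)).2 hj)
  have h2 := max_one_norm (w j)
  rw [h1, max_eq_right hw.le] at h2
  rcases Nat.eq_zero_or_pos (posExp (w j)) with h | h
  · rw [h, pow_zero] at h2
    exact absurd h2 hw.ne'
  · exact ⟨posExp (w j) - 1, j, by rw [Nat.sub_add_cancel h, h2], h1⟩

lemma norm_of_mem_offShell {S : Finset (Fin m)} {k : ℕ} {w : Fin m → ℚ_[p]}
    (hw : w ∈ offShell S k) : ‖w‖ = (p : ℝ) ^ (k + 1) := by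
  obtain ⟨h1, h2⟩ := hw
  simp only [Set.mem_ofPred_eq, not_forall, not_le] at h1 h2
  have hp1 := one_lt_p (p := p)
  refine le_antisymm ((pi_norm_le_iff_of_nonneg (by positivity)).2 fun j => (h1 j).trans ?_) ?_
  · rw [← zpow_natCast]
    exact zpow_le_zpow_right₀ hp1.le (by push_cast; split_ifs <;> omega)
  · obtain ⟨j, hj⟩ := h2
    refine le_trans ?_ (norm_le_pi_norm w j)
    rw [← zpow_natCast]
    push_cast
    by_contra h
    rw [not_le, ← Padic.norm_le_pow_iff_norm_lt_pow_add_one] at h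
    linarith

lemma offRegion_eq_iUnion (S : Finset (Fin m)) :
    (offRegion S : Set (Fin m → ℚ_[p])) = ⋃ k, offShell S k := by
  have hp1 := one_lt_p (p := p)
  ext w
  rw [Set.mem_iUnion]
  constructor
  · rintro ⟨h1, h2⟩
    obtain ⟨k, j, hk, hj⟩ := exists_norm_eq_of_one_lt h1
    refine ⟨k, fun i => ?_, fun h => ?_⟩
    · split_ifs with hi
      · rw [Padic.norm_le_pow_iff_norm_lt_pow_add_one]
        have := h2 i hi
        rw [hk] at this
        exact_mod_cast this
      · have := norm_le_pi_norm w i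
        rw [hk] at this
        exact_mod_cast this
    · have := h j
      rw [Padic.norm_le_pow_iff_norm_lt_pow_add_one, hj, hk] at this
      exact absurd this (not_lt.2 (by norm_cast))
  · rintro ⟨k, hk⟩
    have h1 := norm_of_mem_offShell hk
    refine ⟨?_, fun j hj => ?_⟩
    · rw [h1]
      exact one_lt_pow₀ hp1 (by omega)
    · have := hk.1 j
      rw [if_pos hj, Padic.norm_le_pow_iff_norm_lt_pow_add_one] at this
      rw [h1]
      exact_mod_cast this

lemma measurableSet_offShell (S : Finset (Fin m)) (k : ℕ) :
    MeasurableSet (offShell S k : Set (Fin m → ℚ_[p])) :=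
  (measurableSet_box _).diff (measurableSet_box _)

lemma measurableSet_offRegion (S : Finset (Fin m)) :
    MeasurableSet (offRegion S : Set (Fin m → ℚ_[p])) := by
  rw [offRegion_eq_iUnion]
  exact MeasurableSet.iUnion fun k => measurableSet_offShell S k

/-- A shell is the difference of two nested boxes; only the coordinates outside `S` have the longer
side `p ^ (k + 1)`. -/
lemma haarPi_offShell (S : Finset (Fin m)) (k : ℕ) :
    haarPi p (Fin m) (offShell S k) =
      ENNReal.ofReal ((p : ℝ) ^ (m * k) * ((p : ℝ) ^ (m - S.card) - 1)) := by
  have hp1 := one_lt_p (p := p)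
  have hc : S.card ≤ m := by simpa using S.card_le_univ
  have h1 : haarPi p (Fin m) {w | ∀ j, ‖w j‖ ≤ (p : ℝ) ^ (k : ℤ)} =
      ENNReal.ofReal ((p : ℝ) ^ (m * k)) := by
    rw [haarPi_box (fun _ => (k : ℤ)), Finset.sum_const, Finset.card_univ, Fintype.card_fin,
      ENNReal.ofReal_pow (by positivity), ENNReal.ofReal_natCast, nsmul_eq_mul, ← zpow_natCast]
    norm_cast
  have h2 : haarPi p (Fin m) {w | ∀ j, ‖w j‖ ≤ (p : ℝ) ^ (if j ∈ S then (k : ℤ) else k + 1)} =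
      ENNReal.ofReal ((p : ℝ) ^ (m * k) * (p : ℝ) ^ (m - S.card)) := by
    have : ∑ j : Fin m, (if j ∈ S then (k : ℤ) else k + 1) = ((m * k + (m - S.card) : ℕ) : ℤ) := by
      have : ∀ j : Fin m, (if j ∈ S then (k : ℤ) else k + 1) = k + if j ∈ S then 0 else 1 := by
        intro j; split_ifs <;> simp
      simp_rw [this]
      rw [Finset.sum_add_distrib, Finset.sum_ite]
      simp [Finset.filter_not, Finset.card_sdiff]
    rw [haarPi_box, this, ← pow_add, ENNReal.ofReal_pow (by positivity), ENNReal.ofReal_natCast,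
      zpow_natCast]
  rw [offShell, measure_sdiff _ (measurableSet_box _).nullMeasurableSet, h1, h2,
    ← ENNReal.ofReal_sub _ (by positivity), mul_sub, mul_one]
  · rw [h1]; exact ENNReal.ofReal_ne_top
  · intro w hw j
    refine (hw j).trans (zpow_le_zpow_right₀ hp1.le ?_)
    split_ifs <;> omega

/-- The relative mass of the rows that leave the rank `r` unchanged, where `x = p ^ (-t)`. -/
def stepStay (p m r : ℕ) (x : ℝ) : ℝ := (1 - (p : ℝ) ^ (m - r) * x) / (1 - (p : ℝ) ^ m * x)

/-- The relative mass of the rows that increase the rank `r`, where `x = p ^ (-t)`. -/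
def stepUp (p m r : ℕ) (x : ℝ) : ℝ := x * ((p : ℝ) ^ (m - r) - 1) / (1 - (p : ℝ) ^ m * x)

lemma pow_mul_rpow_lt_one {t : ℝ} (ht : m < t) : (p : ℝ) ^ m * (p : ℝ) ^ (-t) < 1 := by
  rw [← Real.rpow_natCast, ← Real.rpow_add p_pos]
  exact Real.rpow_lt_one_of_one_lt_of_neg one_lt_p (by linarith)

lemma stepUp_nonneg (r : ℕ) {t : ℝ} (ht : m < t) : 0 ≤ stepUp p m r ((p : ℝ) ^ (-t)) := by
  have h1 := pow_mul_rpow_lt_one (p := p) ht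
  have h2 : (1 : ℝ) ≤ (p : ℝ) ^ (m - r) := one_le_pow₀ one_lt_p.le
  exact div_nonneg (mul_nonneg (Real.rpow_nonneg p_pos.le _) (by linarith)) (by linarith)

lemma one_add_stepUp_zero {t : ℝ} (ht : m < t) (r : ℕ) :
    1 + stepUp p m 0 ((p : ℝ) ^ (-t)) - stepUp p m r ((p : ℝ) ^ (-t)) =
      stepStay p m r ((p : ℝ) ^ (-t)) := by
  have h1 := pow_mul_rpow_lt_one (p := p) ht
  have h2 : 1 - (p : ℝ) ^ m * (p : ℝ) ^ (-t) ≠ 0 := by linarith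
  rw [stepUp, stepUp, stepStay, Nat.sub_zero]
  rw [eq_div_iff h2, sub_mul, add_mul, div_mul_cancel₀ _ h2, div_mul_cancel₀ _ h2]
  ring

lemma measurable_radial (t : ℝ) :
    Measurable fun w : Fin m → ℚ_[p] => ENNReal.ofReal (max 1 ‖w‖ ^ (-t)) := by
  fun_prop

lemma lintegral_offRegion (S : Finset (Fin m)) {t : ℝ} (ht : m < t) :
    ∫⁻ w in offRegion S, ENNReal.ofReal (max 1 ‖w‖ ^ (-t)) ∂haarPi p (Fin m) =
      ENNReal.ofReal (stepUp p m S.card ((p : ℝ) ^ (-t))) := by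
  have hp1 := one_lt_p (p := p)
  have hdisj : Pairwise (Function.onFun Disjoint fun k => (offShell S k : Set (Fin m → ℚ_[p]))) := by
    intro k l hkl
    rw [Function.onFun, Set.disjoint_left]
    intro w hk hl
    have h := (norm_of_mem_offShell hk).symm.trans (norm_of_mem_offShell hl)
    have := pow_right_injective₀ p_pos hp1.ne' h
    omega
  have hx := pow_mul_rpow_lt_one (p := p) ht
  set x := (p : ℝ) ^ (-t) with hxdef
  have hx0 : 0 < x := Real.rpow_pos_of_pos p_pos _
  have h2 : (0 : ℝ) ≤ (p : ℝ) ^ (m - S.card) - 1 := sub_nonneg.2 (one_le_pow₀ hp1.le)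
  rw [offRegion_eq_iUnion, lintegral_iUnion (measurableSet_offShell S) hdisj]
  -- The integrand is constant on each shell, so the integral is a geometric series of ratio `p ^ m
  -- * p ^ (-t)`, which is below one because `m < t`.
  have hk (k : ℕ) : ∫⁻ w in offShell S k, ENNReal.ofReal (max 1 ‖w‖ ^ (-t)) ∂haarPi p (Fin m) =
      ENNReal.ofReal (x * ((p : ℝ) ^ (m - S.card) - 1) * ((p : ℝ) ^ m * x) ^ k) := by
    have : ∀ w ∈ (offShell S k : Set (Fin m → ℚ_[p])),
        ENNReal.ofReal (max 1 ‖w‖ ^ (-t)) = ENNReal.ofReal (x ^ (k + 1)) := by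
      intro w hw
      rw [norm_of_mem_offShell hw, max_eq_right (one_le_pow₀ hp1.le), hxdef, ← Real.rpow_natCast,
        ← Real.rpow_natCast, ← Real.rpow_mul p_pos.le, ← Real.rpow_mul p_pos.le, mul_comm]
    rw [setLIntegral_congr_fun (measurableSet_offShell S k) this, setLIntegral_const,
      haarPi_offShell, ← ENNReal.ofReal_mul (by positivity)]
    congr 1
    ring
  simp_rw [hk]
  rw [← ENNReal.ofReal_tsum_of_nonneg (fun k => by positivity)
    ((summable_geometric_of_lt_one (by positivity) hx).mul_left _), tsum_mul_left,
    tsum_geometric_of_lt_one (by positivity) hx, stepUp, div_eq_mul_inv]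

lemma compl_unitBox : (offRegion ∅ : Set (Fin m → ℚ_[p]))ᶜ = {v | ∀ j, ‖v j‖ ≤ 1} := by
  ext w
  simp [offRegion, pi_norm_le_iff_of_nonneg]

lemma lintegral_radial {t : ℝ} (ht : m < t) :
    ∫⁻ w, ENNReal.ofReal (max 1 ‖w‖ ^ (-t)) ∂haarPi p (Fin m) =
      ENNReal.ofReal (1 + stepUp p m 0 ((p : ℝ) ^ (-t))) := by
  rw [← lintegral_add_compl _ (measurableSet_offRegion (∅ : Finset (Fin m))),
    lintegral_offRegion _ ht, Finset.card_empty, add_comm, ENNReal.ofReal_add zero_le_one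
    (stepUp_nonneg _ ht), ENNReal.ofReal_one]
  congr 1
  have : ∀ w ∈ (offRegion ∅ : Set (Fin m → ℚ_[p]))ᶜ, ENNReal.ofReal (max 1 ‖w‖ ^ (-t)) = 1 := by
    intro w hw
    rw [compl_unitBox] at hw
    rw [max_eq_left ((pi_norm_le_iff_of_nonneg zero_le_one).2 hw)]
    simp
  rw [setLIntegral_congr_fun (measurableSet_offRegion _).compl this, setLIntegral_const,
    compl_unitBox, haarPi_unitBox, one_mul]

/-- Obtained by subtraction from the full integral, in which the unit box contributes one and its
complement is the region with `S = ∅`. -/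
lemma lintegral_offRegion_compl (S : Finset (Fin m)) {t : ℝ} (ht : m < t) :
    ∫⁻ w in (offRegion S)ᶜ, ENNReal.ofReal (max 1 ‖w‖ ^ (-t)) ∂haarPi p (Fin m) =
      ENNReal.ofReal (stepStay p m S.card ((p : ℝ) ^ (-t))) := by
  have h := lintegral_add_compl (μ := haarPi p (Fin m))
    (fun w : Fin m → ℚ_[p] => ENNReal.ofReal (max 1 ‖w‖ ^ (-t))) (measurableSet_offRegion S)
  rw [lintegral_offRegion S ht, lintegral_radial ht, add_comm] at h
  rw [ENNReal.eq_sub_of_add_eq ENNReal.ofReal_ne_top h,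
    ← ENNReal.ofReal_sub _ (stepUp_nonneg _ ht), one_add_stepUp_zero ht]

/-- The norm `p ^ (k + 1)` is attained outside `S`, where the entries get divided in norm by `p`;
entries in `S` already have norm at most `p ^ k`. -/
lemma max_norm_of_mem_offRegion {S : Finset (Fin m)} {w : Fin m → ℚ_[p]} (hw : w ∈ offRegion S) :
    max 1 ‖w‖ = p * max 1 ‖fun j => if j ∈ S then w j else p * w j‖ := by
  have hp1 := one_lt_p (p := p)
  obtain ⟨h1, h2⟩ := hw
  obtain ⟨k, j, hk, hj⟩ := exists_norm_eq_of_one_lt h1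
  have hjS : j ∉ S := fun h => (h2 j h).ne hj
  have hn : ‖fun j => if j ∈ S then w j else p * w j‖ = (p : ℝ) ^ k := by
    refine le_antisymm ((pi_norm_le_iff_of_nonneg (by positivity)).2 fun i => ?_) ?_
    · split_ifs with hi
      · have := h2 i hi
        rw [hk] at this
        rw [← zpow_natCast, Padic.norm_le_pow_iff_norm_lt_pow_add_one]
        exact_mod_cast this
      · rw [norm_mul, Padic.norm_p, inv_mul_le_iff₀ p_pos, ← pow_succ', ← hk]
        exact norm_le_pi_norm w i
    · have := norm_le_pi_norm (fun j => if j ∈ S then w j else p * w j) j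
      simp only [hjS, if_false] at this
      refine le_trans ?_ this
      rw [norm_mul, Padic.norm_p, hj, hk, pow_succ', inv_mul_cancel_left₀ p_pos.ne']
  rw [hn, hk, max_eq_right (one_le_pow₀ hp1.le), max_eq_right (one_le_pow₀ hp1.le), pow_succ']

/-- Either `w` is integral, or its norm is attained in `S`, where the entries are untouched. -/
lemma max_norm_of_notMem_offRegion {S : Finset (Fin m)} {w : Fin m → ℚ_[p]}
    (hw : w ∉ offRegion S) :
    max 1 ‖w‖ = max 1 ‖fun j => if j ∈ S then w j else p * w j‖ := by
  have hle : ‖fun j => if j ∈ S then w j else p * w j‖ ≤ ‖w‖ := by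
    refine (pi_norm_le_iff_of_nonneg (norm_nonneg _)).2 fun i => ?_
    split_ifs
    · exact norm_le_pi_norm w i
    · rw [norm_mul, Padic.norm_p]
      exact (mul_le_of_le_one_left (norm_nonneg _) (inv_le_one_of_one_le₀ one_lt_p.le)).trans
        (norm_le_pi_norm w i)
  by_cases h1 : 1 < ‖w‖
  · have : ∃ j ∈ S, ‖w‖ ≤ ‖w j‖ := by
      by_contra! h
      exact hw ⟨h1, h⟩
    obtain ⟨j, hj, h⟩ := this
    have h3 := norm_le_pi_norm (fun j => if j ∈ S then w j else p * w j) j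
    simp only [hj, if_true] at h3
    rw [hle.antisymm (h.trans h3)]
  · rw [not_lt] at h1
    rw [max_eq_left h1, max_eq_left (hle.trans h1)]

/-- The rank is the logarithm of a ratio of two volumes. The new row multiplies them by two maxima,
which differ by a factor `p` on the off region and agree elsewhere. -/
lemma Adapted.posRank_insRow {Z : Matrix (Fin n) (Fin m) ℚ_[p]} {C : GL (Fin m) ℤ_[p]}
    {e : Fin m → ℕ} (h : Adapted Z C e) (i : Fin (n + 1)) (v : Fin m → ℚ_[p])
    [Decidable (latticeCoord C e v ∈ offRegion (Finset.univ.filter fun j => 0 < e j))] :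
    posRank (insRow i v Z) = posRank Z +
      if latticeCoord C e v ∈ offRegion (Finset.univ.filter fun j => 0 < e j) then 1 else 0 := by
  apply posRank_eq_of_latVol
  have h0 := latVol_div_eq Z
  rw [div_eq_iff (latVol_pos _).ne'] at h0
  rw [h.latVol_insRow, h.latVol_smul_insRow, h0]
  split_ifs with hv
  · rw [max_norm_of_mem_offRegion hv]
    simp only [Finset.mem_filter, Finset.mem_univ, true_and]
    ring
  · rw [max_norm_of_notMem_offRegion hv]
    simp only [Finset.mem_filter, Finset.mem_univ, true_and]
    ring

/-- Integration over one additional row. -/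
theorem lintegral_insRow (i : Fin (n + 1)) (Z : Matrix (Fin n) (Fin m) ℚ_[p]) {t : ℝ} (ht : m < t)
    (f : ℕ → ℝ≥0∞) :
    ∫⁻ v, f (posRank (insRow i v Z)) * ENNReal.ofReal (latVol (insRow i v Z) ^ (-t))
        ∂haarPi p (Fin m) =
      ENNReal.ofReal (latVol Z ^ (1 - t)) *
        (f (posRank Z) * ENNReal.ofReal (stepStay p m (posRank Z) ((p : ℝ) ^ (-t))) +
          f (posRank Z + 1) * ENNReal.ofReal (stepUp p m (posRank Z) ((p : ℝ) ^ (-t)))) := by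
  classical
  obtain ⟨C, e, h⟩ := exists_adapted Z
  set S := Finset.univ.filter fun j => 0 < e j with hS
  have hr : posRank Z = S.card := h.posRank_eq
  let φ := (latticeCoord (p := p) C e).toContinuousLinearEquiv.toHomeomorph.toMeasurableEquiv
  have hφ : (haarPi p (Fin m)).map φ = (p : ℝ≥0∞) ^ (∑ j, e j) • haarPi p (Fin m) :=
    map_latticeCoord C e
  let G : (Fin m → ℚ_[p]) → ℝ≥0∞ := fun w =>
    f (posRank Z + if w ∈ offRegion S then 1 else 0) *
      (ENNReal.ofReal (latVol Z ^ (-t)) * ENNReal.ofReal (max 1 ‖w‖ ^ (-t)))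
  have hG : ∀ v, f (posRank (insRow i v Z)) * ENNReal.ofReal (latVol (insRow i v Z) ^ (-t)) =
      G (φ v) := by
    intro v
    rw [h.posRank_insRow, h.latVol_insRow, Real.mul_rpow (latVol_pos _).le (by positivity),
      ENNReal.ofReal_mul (Real.rpow_nonneg (latVol_pos _).le _)]
    rfl
  simp_rw [hG]
  rw [← lintegral_map_equiv, hφ, lintegral_smul_measure,
    ← lintegral_add_compl _ (measurableSet_offRegion S)]
  have hm := measurable_radial (p := p) (m := m) t
  have h1 : ∫⁻ w in offRegion S, G w ∂haarPi p (Fin m) = f (posRank Z + 1) *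
      (ENNReal.ofReal (latVol Z ^ (-t)) *
        ENNReal.ofReal (stepUp p m (posRank Z) ((p : ℝ) ^ (-t)))) := by
    rw [hr, ← lintegral_offRegion S ht, ← lintegral_const_mul _ hm,
      ← lintegral_const_mul _ (hm.const_mul _)]
    refine setLIntegral_congr_fun (measurableSet_offRegion S) fun w hw => ?_
    simp only [G, hw, if_true, hr]
  have h2 : ∫⁻ w in (offRegion S)ᶜ, G w ∂haarPi p (Fin m) = f (posRank Z) *
      (ENNReal.ofReal (latVol Z ^ (-t)) *
        ENNReal.ofReal (stepStay p m (posRank Z) ((p : ℝ) ^ (-t)))) := by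
    rw [hr, ← lintegral_offRegion_compl S ht, ← lintegral_const_mul _ hm,
      ← lintegral_const_mul _ (hm.const_mul _)]
    refine setLIntegral_congr_fun (measurableSet_offRegion S).compl fun w hw => ?_
    have hw' : w ∉ offRegion S := hw
    simp only [G, hw', if_false, hr, add_zero]
  rw [h1, h2]
  -- The Jacobian of the adapted coordinates equals `latVol Z`, which raises the exponent from `-t`
  -- to `1 - t`.
  have h3 : ENNReal.ofReal (latVol Z ^ (1 - t)) =
      (p : ℝ≥0∞) ^ (∑ j, e j) * ENNReal.ofReal (latVol Z ^ (-t)) := by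
    rw [sub_eq_add_neg, Real.rpow_add (latVol_pos _), Real.rpow_one,
      ENNReal.ofReal_mul (latVol_pos _).le]
    congr 1
    rw [h.latVol_eq, ENNReal.ofReal_pow (by positivity), ENNReal.ofReal_natCast]
  rw [h3, smul_eq_mul]
  ring

end

/-! ### Integrating out the last row and the last column. -/

section

variable {p : ℕ} [hp : Fact p.Prime] {n m : ℕ}

/-- The Haar measure on rectangular `p`-adic matrices giving mass one to integral matrices. -/
def volRect (p : ℕ) [Fact p.Prime] (n m : ℕ) : Measure (Matrix (Fin n) (Fin m) ℚ_[p]) :=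
  Measure.pi fun _ : Fin n => Measure.pi fun _ : Fin m => haarQ p

/-- Such a function is constant on closed unit balls, so all its preimages are open. Volume and rank
are of this kind. -/
lemma measurable_of_add_integral {β : Type*} [MeasurableSpace β]
    {f : Matrix (Fin n) (Fin m) ℚ_[p] → β}
    (hf : ∀ Z X : Matrix (Fin n) (Fin m) ℚ_[p], (∀ i j, ‖X i j‖ ≤ 1) → f (Z + X) = f Z) :
    Measurable f := by
  intro s _
  let f' : (Fin n → Fin m → ℚ_[p]) → β := f
  have : IsOpen (f' ⁻¹' s) := by
    rw [isOpen_iff_mem_nhds]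
    intro Z hZ
    refine mem_of_superset (Metric.closedBall_mem_nhds Z zero_lt_one) fun Z' hZ' => ?_
    have h1 : f Z' = f Z := by
      have := hf Z (Z' - Z) fun i j => ?_
      · exact (congrArg f (add_sub_cancel Z Z' : Z + (Z' - Z) = Z')).symm.trans this
      · rw [mem_closedBall_iff_norm] at hZ'
        exact ((norm_le_pi_norm ((Z' - Z) i) j).trans (norm_le_pi_norm (Z' - Z) i)).trans hZ'
    change f Z' ∈ s
    rw [h1]
    exact hZ
  exact this.measurableSet

lemma measurable_latVol : Measurable (latVol : Matrix (Fin n) (Fin m) ℚ_[p] → ℝ) :=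
  measurable_of_add_integral latVol_add

lemma measurable_posRank : Measurable (posRank : Matrix (Fin n) (Fin m) ℚ_[p] → ℕ) :=
  measurable_of_add_integral posRank_add

lemma lintegral_volRect_succ (i : Fin (n + 1)) {F : Matrix (Fin (n + 1)) (Fin m) ℚ_[p] → ℝ≥0∞}
    (hF : Measurable F) :
    ∫⁻ Z, F Z ∂volRect p (n + 1) m =
      ∫⁻ Z, ∫⁻ v, F (insRow i v Z) ∂haarPi p (Fin m) ∂volRect p n m := by
  have h := (measurePreserving_piFinSuccAbove
    (fun _ : Fin (n + 1) => haarPi p (Fin m)) i).symm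
  have h1 := h.lintegral_comp hF
  have h2 := lintegral_prod_symm (μ := haarPi p (Fin m))
    (ν := Measure.pi fun _ : Fin n => haarPi p (Fin m))
    (fun x => F ((MeasurableEquiv.piFinSuccAbove (fun _ => Fin m → ℚ_[p]) i).symm x))
    (hF.comp (MeasurableEquiv.measurable _)).aemeasurable
  exact h1.symm.trans h2

lemma measurable_insRow (i : Fin (n + 1)) (Z : Matrix (Fin n) (Fin m) ℚ_[p]) :
    Measurable fun v => insRow i v Z := by
  refine measurable_pi_lambda _ fun k => measurable_pi_lambda _ fun j => ?_
  refine Fin.succAboveCases i ?_ (fun k => ?_) k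
  · simpa using measurable_pi_apply j
  · simp

lemma measurable_transpose :
    Measurable (Matrix.transpose : Matrix (Fin n) (Fin m) ℚ_[p] → Matrix (Fin m) (Fin n) ℚ_[p]) :=
  measurable_pi_lambda _ fun j => measurable_pi_lambda _ fun i =>
    (measurable_pi_apply j).comp (measurable_pi_apply i)

lemma volRect_integral :
    volRect p n m {Z | ∀ i j, ‖Z i j‖ ≤ 1} = 1 := by
  have h : {Z : Fin n → Fin m → ℚ_[p] | ∀ i j, ‖Z i j‖ ≤ 1} =
      Set.pi Set.univ fun _ => {v | ∀ j, ‖v j‖ ≤ 1} := by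
    ext Z; simp
  have h1 : (Measure.pi fun _ : Fin n => haarPi p (Fin m))
      {Z : Fin n → Fin m → ℚ_[p] | ∀ i j, ‖Z i j‖ ≤ 1} = 1 := by
    rw [h, Measure.pi_pi]
    simp [haarPi_unitBox]
  exact h1

lemma map_transpose_volRect :
    (volRect p n m).map Matrix.transpose = volRect p m n := by
  let T : (Fin n → Fin m → ℚ_[p]) ≃ₗ[ℚ_[p]] (Fin m → Fin n → ℚ_[p]) :=
    Matrix.transposeLinearEquiv (Fin n) (Fin m) ℚ_[p] ℚ_[p]
  let T' := T.toContinuousLinearEquiv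
  let μ : Measure (Fin n → Fin m → ℚ_[p]) := Measure.pi fun _ : Fin n => haarPi p (Fin m)
  let ν : Measure (Fin m → Fin n → ℚ_[p]) := Measure.pi fun _ : Fin m => haarPi p (Fin n)
  have : (μ.map T').IsAddHaarMeasure := T'.isAddHaarMeasure_map _
  have hs : MeasurableSet {Z : Fin m → Fin n → ℚ_[p] | ∀ i j, ‖Z i j‖ ≤ 1} := by
    have : {Z : Fin m → Fin n → ℚ_[p] | ∀ i j, ‖Z i j‖ ≤ 1} =
      Set.pi Set.univ fun _ => {v | ∀ j, ‖v j‖ ≤ 1} := by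
      ext Z; simp
    rw [this]
    exact MeasurableSet.univ_pi fun _ => measurableSet_box _
  have h := addHaar_eq_smul (μ.map T') ν _ volRect_integral
  have h2 : μ.map T' {Z : Fin m → Fin n → ℚ_[p] | ∀ i j, ‖Z i j‖ ≤ 1} = 1 := by
    rw [Measure.map_apply T'.continuous.measurable hs]
    refine Eq.trans (congrArg μ ?_) (volRect_integral (p := p) (n := n) (m := m))
    ext Z
    exact forall_comm
  exact h.trans ((congrArg (· • ν) h2).trans (one_smul _ _))

lemma lintegral_volRect_transpose {F : Matrix (Fin m) (Fin n) ℚ_[p] → ℝ≥0∞} (hF : Measurable F) :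
    ∫⁻ Z, F Z ∂volRect p m n = ∫⁻ Z, F Z.transpose ∂volRect p n m := by
  rw [← map_transpose_volRect, lintegral_map hF measurable_transpose]

/-- Total relative mass of an additional row of length `m`, where `x = p ^ (-t)`. -/
def stepTotal (p m : ℕ) (x : ℝ) : ℝ := (1 - x) / (1 - (p : ℝ) ^ m * x)

lemma stepStay_nonneg (r : ℕ) {t : ℝ} (ht : m < t) : 0 ≤ stepStay p m r ((p : ℝ) ^ (-t)) := by
  have h1 := pow_mul_rpow_lt_one (p := p) ht
  have h2 : (p : ℝ) ^ (m - r) ≤ (p : ℝ) ^ m := pow_le_pow_right₀ one_lt_p.le (Nat.sub_le _ _)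
  have h3 : 0 ≤ (p : ℝ) ^ (-t) := Real.rpow_nonneg p_pos.le _
  exact div_nonneg (by nlinarith) (by linarith)

lemma stepStay_add_stepUp {t : ℝ} (ht : m < t) (r : ℕ) :
    stepStay p m r ((p : ℝ) ^ (-t)) + stepUp p m r ((p : ℝ) ^ (-t)) =
      stepTotal p m ((p : ℝ) ^ (-t)) := by
  have h1 := pow_mul_rpow_lt_one (p := p) ht
  have h2 : 1 - (p : ℝ) ^ m * (p : ℝ) ^ (-t) ≠ 0 := by linarith
  rw [stepStay, stepUp, stepTotal, ← add_div]
  congr 1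
  ring

/-- The rank cancels in the sum of the stay and up masses. This independence is the source of the
consistency of the Hua measures. -/
lemma lintegral_insRow_total (i : Fin (n + 1)) (Z : Matrix (Fin n) (Fin m) ℚ_[p]) {t : ℝ}
    (ht : m < t) :
    ∫⁻ v, ENNReal.ofReal (latVol (insRow i v Z) ^ (-t)) ∂haarPi p (Fin m) =
      ENNReal.ofReal (stepTotal p m ((p : ℝ) ^ (-t))) * ENNReal.ofReal (latVol Z ^ (1 - t)) := by
  have h := lintegral_insRow i Z ht fun _ => 1
  simp only [one_mul] at h
  rw [h, ← ENNReal.ofReal_add (stepStay_nonneg _ ht) (stepUp_nonneg _ ht), stepStay_add_stepUp ht,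
    mul_comm]

lemma measurable_latVol_rpow (t : ℝ) :
    Measurable fun Z : Matrix (Fin n) (Fin m) ℚ_[p] => ENNReal.ofReal (latVol Z ^ t) :=
  (measurable_latVol.pow_const t).ennreal_ofReal

/-- Forget the last column. -/
def dropCol (Z : Matrix (Fin n) (Fin (m + 1)) ℚ_[p]) : Matrix (Fin n) (Fin m) ℚ_[p] :=
  Z.submatrix id Fin.castSucc

/-- Forget the last row and the last column. -/
def dropLast (Z : Matrix (Fin (n + 1)) (Fin (m + 1)) ℚ_[p]) : Matrix (Fin n) (Fin m) ℚ_[p] :=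
  Z.submatrix Fin.castSucc Fin.castSucc

lemma measurable_submatrix {ι κ ι' κ' : Type*} (f : ι' → ι) (g : κ' → κ) :
    Measurable fun Z : Matrix ι κ ℚ_[p] => Z.submatrix f g :=
  measurable_pi_lambda _ fun i => measurable_pi_lambda _ fun j =>
    (measurable_pi_apply (g j)).comp (measurable_pi_apply (f i))

lemma dropLast_insRow (v : Fin (m + 1) → ℚ_[p]) (Z : Matrix (Fin n) (Fin (m + 1)) ℚ_[p]) :
    dropLast (insRow (Fin.last n) v Z) = dropCol Z := by
  ext i j
  simpa [dropLast, dropCol] using insRow_succAbove (Fin.last n) v Z i j.castSucc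

lemma dropCol_transpose_insRow (v : Fin n → ℚ_[p]) (Z : Matrix (Fin m) (Fin n) ℚ_[p]) :
    dropCol (insRow (Fin.last m) v Z).transpose = Z.transpose := by
  ext i j
  simpa [dropCol] using insRow_succAbove (Fin.last m) v Z j i

/-- Integrating out the last row and the last column. -/
theorem lintegral_dropLast {t : ℝ} (ht : n + 1 < t) (ht' : m + 1 < t)
    {g : Matrix (Fin n) (Fin m) ℚ_[p] → ℝ≥0∞} (hg : Measurable g) :
    ∫⁻ Z, g (dropLast Z) * ENNReal.ofReal (latVol Z ^ (-t)) ∂volRect p (n + 1) (m + 1) =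
      ENNReal.ofReal (stepTotal p (m + 1) ((p : ℝ) ^ (-t)) * stepTotal p n ((p : ℝ) ^ (1 - t))) *
        ∫⁻ W, g W * ENNReal.ofReal (latVol W ^ (2 - t)) ∂volRect p n m := by
  have hp1 := one_lt_p (p := p)
  have hT : 0 ≤ stepTotal p (m + 1) ((p : ℝ) ^ (-t)) := by
    rw [← stepStay_add_stepUp (by exact_mod_cast ht') 0]
    exact add_nonneg (stepStay_nonneg _ (by exact_mod_cast ht'))
      (stepUp_nonneg _ (by exact_mod_cast ht'))
  have hmeas0 : Measurable fun Z : Matrix (Fin (n + 1)) (Fin (m + 1)) ℚ_[p] =>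
      g (dropLast Z) * ENNReal.ofReal (latVol Z ^ (-t)) :=
    (hg.comp (measurable_submatrix _ _)).mul (measurable_latVol_rpow _)
  rw [lintegral_volRect_succ (Fin.last n) hmeas0]
  simp_rw [dropLast_insRow]
  have h1 (Z : Matrix (Fin n) (Fin (m + 1)) ℚ_[p]) :
      ∫⁻ v, g (dropCol Z) * ENNReal.ofReal (latVol (insRow (Fin.last n) v Z) ^ (-t))
        ∂haarPi p (Fin (m + 1)) = ENNReal.ofReal (stepTotal p (m + 1) ((p : ℝ) ^ (-t))) *
          (g (dropCol Z) * ENNReal.ofReal (latVol Z ^ (1 - t))) := by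
    rw [lintegral_const_mul _ ?_, lintegral_insRow_total _ _ (by exact_mod_cast ht')]
    · ring
    · exact (measurable_latVol_rpow _).comp (measurable_insRow _ _)
  simp_rw [h1]
  have hmeas : Measurable fun Z : Matrix (Fin n) (Fin (m + 1)) ℚ_[p] =>
      g (dropCol Z) * ENNReal.ofReal (latVol Z ^ (1 - t)) :=
    (hg.comp (measurable_submatrix _ _)).mul (measurable_latVol_rpow _)
  rw [lintegral_const_mul _ hmeas, lintegral_volRect_transpose hmeas,
    lintegral_volRect_succ (F := fun Z : Matrix (Fin (m + 1)) (Fin n) ℚ_[p] =>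
      g (dropCol Z.transpose) * ENNReal.ofReal (latVol Z.transpose ^ (1 - t))) (Fin.last m)
      (hmeas.comp measurable_transpose)]
  simp_rw [dropCol_transpose_insRow, latVol_transpose]
  -- The column has length `n`, since the last row is gone, and its exponent is now `t - 1`.
  have ht2 : (n : ℝ) < t - 1 := by linarith
  have h2 (Z : Matrix (Fin m) (Fin n) ℚ_[p]) :
      ∫⁻ v, g Z.transpose * ENNReal.ofReal (latVol (insRow (Fin.last m) v Z) ^ (1 - t))
        ∂haarPi p (Fin n) = ENNReal.ofReal (stepTotal p n ((p : ℝ) ^ (1 - t))) *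
          (g Z.transpose * ENNReal.ofReal (latVol Z.transpose ^ (2 - t))) := by
    have := lintegral_insRow_total (Fin.last m) Z ht2
    rw [neg_sub, show 1 - (t - 1) = 2 - t by ring] at this
    rw [lintegral_const_mul _ ?_, this, latVol_transpose]
    · ring
    · exact (measurable_latVol_rpow _).comp (measurable_insRow _ _)
  simp_rw [h2]
  have hmeas2 : Measurable fun Z : Matrix (Fin n) (Fin m) ℚ_[p] =>
      g Z * ENNReal.ofReal (latVol Z ^ (2 - t)) := hg.mul (measurable_latVol_rpow _)
  rw [lintegral_const_mul (f := fun Z : Matrix (Fin m) (Fin n) ℚ_[p] =>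
    g Z.transpose * ENNReal.ofReal (latVol Z.transpose ^ (2 - t))) _
    (hmeas2.comp measurable_transpose), ← lintegral_volRect_transpose hmeas2,
    ← mul_assoc, ENNReal.ofReal_mul hT]

end

/-! ### Projective limits of probability measures. -/

section

lemma compProd_map_left {α β γ : Type*} [MeasurableSpace α] [MeasurableSpace β]
    [MeasurableSpace γ] (ν : Measure α) [IsFiniteMeasure ν] (η : Kernel β γ) [IsMarkovKernel η]
    {g : α → β} (hg : Measurable g) :
    (ν.map g) ⊗ₘ η = (ν ⊗ₘ (η.comap g hg)).map (Prod.map g id) := by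
  ext s hs
  rw [Measure.compProd_apply hs, Measure.map_apply (by fun_prop) hs,
    Measure.compProd_apply ((hg.prodMap measurable_id) hs),
    lintegral_map (Kernel.measurable_kernel_prodMk_left hs) hg]
  rfl

/-- Inverse limits of probability measures on standard Borel spaces exist, as laws of sequences
that are almost surely compatible. -/
theorem exists_compatible_measure {E : ℕ → Type*} [∀ k, MeasurableSpace (E k)]
    [∀ k, StandardBorelSpace (E k)] [∀ k, Nonempty (E k)] (f : ∀ k, E (k + 1) → E k)
    (hf : ∀ k, Measurable (f k)) (μ : ∀ k, Measure (E k)) [∀ k, IsProbabilityMeasure (μ k)]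
    (hμ : ∀ k, (μ (k + 1)).map (f k) = μ k) :
    ∃ P : Measure (∀ k, E k), IsProbabilityMeasure P ∧ (∀ k, P.map (fun x => x k) = μ k) ∧
      ∀ k, ∀ᵐ x ∂P, f k (x (k + 1)) = x k := by
  -- The law of a point of level `k + 1` given its image in level `k`. The Markov chain driven by
  -- these kernels has the right marginals and moves along fibres of `f` almost surely.
  let η (k : ℕ) : Kernel (E k) (E (k + 1)) := condDistrib id (f k) (μ (k + 1))
  let κ (k : ℕ) : Kernel (∀ i : Finset.Iic k, E i) (E (k + 1)) :=
    (η k).comap (fun x => x ⟨k, by simp⟩) (measurable_pi_apply _)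
  let P := Kernel.trajMeasure (μ 0) κ
  have hP : IsProbabilityMeasure P := inferInstance
  have hηdef (k : ℕ) : (μ k) ⊗ₘ (η k) = (μ (k + 1)).map (fun z => (f k z, z)) := by
    have := compProd_map_condDistrib (μ := μ (k + 1)) (X := f k) (Y := id)
      (mβ := inferInstance) aemeasurable_id
    rw [hμ] at this
    exact this
  have hjoint (k : ℕ) (h : P.map (fun x => x k) = μ k) :
      P.map (fun x => (x k, x (k + 1))) = (μ (k + 1)).map (fun z => (f k z, z)) := by
    rw [← hηdef, ← h]
    have h1 : P.map (fun x => x k) =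
        (P.map (Preorder.frestrictLe k)).map (fun x => x ⟨k, by simp⟩) := by
      rw [Measure.map_map (measurable_pi_apply _) (by fun_prop)]
      rfl
    have hfin : IsProbabilityMeasure (P.map (Preorder.frestrictLe (π := E) k)) :=
      Measure.isProbabilityMeasure_map (by fun_prop)
    rw [h1, compProd_map_left _ _ (measurable_pi_apply _)]
    have h2 : P.map (Preorder.frestrictLe k) ⊗ₘ κ k =
        P.map (fun x => (Preorder.frestrictLe k x, x (k + 1))) :=
      Kernel.map_frestrictLe_trajMeasure_compProd_eq_map_trajMeasure
    change _ = Measure.map _ (P.map (Preorder.frestrictLe k) ⊗ₘ κ k)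
    rw [h2, Measure.map_map (by fun_prop) (by fun_prop)]
    rfl
  have hmarg (k : ℕ) : P.map (fun x => x k) = μ k := by
    induction k with
    | zero =>
      have h1 : P.map (fun x => x 0) =
          (P.map (Preorder.frestrictLe 0)).map (fun x => x ⟨0, by simp⟩) := by
        rw [Measure.map_map (measurable_pi_apply _) (by fun_prop)]
        rfl
      have h2 : P.map (Preorder.frestrictLe 0) = (μ 0).map (MeasurableEquiv.piUnique _).symm := by
        change Measure.map _ (Kernel.trajMeasure (μ 0) κ) = _
        rw [Kernel.trajMeasure, Measure.map_comp _ _ (by fun_prop), Kernel.traj_map_frestrictLe,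
          Kernel.partialTraj_self, Measure.id_comp]
      rw [h1, h2]
      have h3 : (fun x : ∀ i : Finset.Iic 0, E i => x ⟨0, by simp⟩) ∘
          (MeasurableEquiv.piUnique fun i : Finset.Iic 0 => E i).symm = id :=
        funext fun x => (MeasurableEquiv.piUnique fun i : Finset.Iic 0 => E i).apply_symm_apply x
      exact (Measure.map_map (measurable_pi_apply (⟨0, by simp⟩ : Finset.Iic 0))
        (MeasurableEquiv.measurable _)).trans ((congrArg (Measure.map · (μ 0)) h3).trans
          Measure.map_id)
    | succ k ih =>
      have := congrArg (Measure.map Prod.snd) (hjoint k ih)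
      rw [Measure.map_map measurable_snd (by fun_prop),
        Measure.map_map measurable_snd (by fun_prop)] at this
      exact this.trans Measure.map_id
  refine ⟨P, hP, hmarg, fun k => ?_⟩
  have h1 : ∀ᵐ z ∂(μ (k + 1)).map (fun z => (f k z, z)), f k z.2 = z.1 := by
    rw [ae_map_iff (by fun_prop) (measurableSet_eq_fun (by fun_prop) measurable_fst)]
    simp
  rw [← hjoint k (hmarg k)] at h1
  exact ae_of_ae_map (by fun_prop) h1

end

/-! ### Singular numbers in terms of lattices. -/

section

variable {p : ℕ} [hp : Fact p.Prime]

section singular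

variable {N : ℕ}

lemma exists_unit_mul_padicPowNeg (x : ℚ_[p]) :
    ∃ (u : ℤ_[p]ˣ) (k : WithBot ℤ), x = ((u : ℤ_[p]) : ℚ_[p]) * padicPowNeg p k := by
  by_cases hx : x = 0
  · exact ⟨1, ⊥, by simp [hx, padicPowNeg]⟩
  have hp0 : (p : ℚ_[p]) ≠ 0 := by exact_mod_cast hp.out.ne_zero
  have hu : ‖x * (p : ℚ_[p]) ^ (-x.valuation)‖ = 1 := by
    rw [norm_mul, norm_p_zpow, neg_neg, Padic.norm_eq_zpow_neg_valuation hx,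
      ← zpow_add₀ p_pos.ne', neg_add_cancel, zpow_zero]
  refine ⟨PadicInt.mkUnits hu, ((-x.valuation : ℤ) : WithBot ℤ), ?_⟩
  rw [PadicInt.mkUnits_eq]
  simp only [padicPowNeg, neg_neg]
  rw [mul_assoc, ← zpow_add₀ hp0, neg_add_cancel, zpow_zero, mul_one]

lemma rdiag_eq_diagonal (d : ℕ → ℚ_[p]) :
    rdiag N N d = Matrix.diagonal fun j : Fin N => d j := by
  ext i j
  simp only [rdiag, Matrix.of_apply, Matrix.diagonal_apply, Fin.ext_iff]

lemma smithEquiv_diagonal_units (u : Fin N → ℤ_[p]ˣ) (d : Fin N → ℚ_[p]) :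
    SmithEquiv (Matrix.diagonal fun j => ((u j : ℤ_[p]) : ℚ_[p]) * d j) (Matrix.diagonal d) := by
  let U : GL (Fin N) ℤ_[p] :=
    ⟨Matrix.diagonal fun j => (u j : ℤ_[p]), Matrix.diagonal fun j => ((u j)⁻¹ : ℤ_[p]ˣ),
      by simp, by simp⟩
  refine ⟨U, 1, ?_⟩
  have : toQ (U : Matrix (Fin N) (Fin N) ℤ_[p]) =
      Matrix.diagonal fun j => ((u j : ℤ_[p]) : ℚ_[p]) := by
    ext i j
    by_cases h : i = j <;> simp [toQ, U, h]
  rw [this, Units.val_one, toQ_one, Matrix.mul_one, Matrix.diagonal_mul_diagonal]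

theorem exists_isSingularNumbers (Z : Matrix (Fin N) (Fin N) ℚ_[p]) :
    ∃ k, IsSingularNumbers Z k := by
  obtain ⟨d, hd⟩ := exists_smithEquiv_rdiag N N Z
  choose u k huk using fun j : Fin N => exists_unit_mul_padicPowNeg (d j)
  rw [rdiag_eq_diagonal] at hd
  simp_rw [huk] at hd
  have h1 := hd.trans (smithEquiv_diagonal_units u _)
  -- Sorting in the dual order, as singular numbers are listed in decreasing order.
  let σ : Equiv.Perm (Fin N) := Tuple.sort (fun j => OrderDual.toDual (k j))
  have h2 := smithEquiv_submatrix (Matrix.diagonal fun j => padicPowNeg p (k j)) σ σ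
  rw [Matrix.submatrix_diagonal_equiv] at h2
  exact ⟨k ∘ σ, Tuple.monotone_sort (fun j => OrderDual.toDual (k j)), h1.trans h2.symm⟩

lemma isSingularNumbers_sing (Z : Matrix (Fin N) (Fin N) ℚ_[p]) : IsSingularNumbers Z (sing Z) :=
  Classical.epsilon_spec (exists_isSingularNumbers Z)

lemma posExp_padicPowNeg (k : WithBot ℤ) :
    posExp (padicPowNeg p k) = (k.unbotD 0).toNat := by
  induction k using WithBot.recBotCoe with
  | bot => simp [posExp, padicPowNeg]
  | coe k =>
    simp [posExp, padicPowNeg]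

/-- Links the chosen tuple of singular numbers to lattice volumes. Any admissible tuple would do, so
uniqueness of singular numbers plays no role. -/
lemma exists_adapted_sing (Z : Matrix (Fin N) (Fin N) ℚ_[p]) :
    ∃ C, Adapted Z C fun j => ((sing Z j).unbotD 0).toNat := by
  obtain ⟨-, B, C, h⟩ := isSingularNumbers_sing Z
  refine ⟨C⁻¹, ?_⟩
  have h1 := adapted_of_smith B C (fun i => if h : i < N then padicPowNeg p (sing Z ⟨i, h⟩) else 0)
  rw [rdiag_eq_diagonal] at h1
  simp only [Fin.is_lt, if_true, dif_pos, posExp_padicPowNeg] at h1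
  convert h1 using 1
  exact h

lemma toNat_unbotD_pos_iff (k : WithBot ℤ) : 0 < (k.unbotD 0).toNat ↔ 0 < k := by
  induction k using WithBot.recBotCoe with
  | bot => simp
  | coe k => simp

lemma posRank_eq_card (Z : Matrix (Fin N) (Fin N) ℚ_[p]) :
    posRank Z = (Finset.univ.filter fun j => 0 < sing Z j).card := by
  obtain ⟨C, h⟩ := exists_adapted_sing Z
  rw [h.posRank_eq]
  simp_rw [toNat_unbotD_pos_iff]

lemma gam_eq_latVol (Z : Matrix (Fin N) (Fin N) ℚ_[p]) : gam Z = latVol Z := by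
  obtain ⟨C, h⟩ := exists_adapted_sing Z
  rw [h.latVol_eq, gam, ← Finset.prod_pow_eq_pow_sum, Finset.prod_filter]
  refine Finset.prod_congr rfl fun j _ => ?_
  have hk := toNat_unbotD_pos_iff (sing Z j)
  split_ifs with hj
  · rw [← zpow_natCast, Int.toNat_of_nonneg (by have := hk.2 hj; omega)]
  · rw [Nat.eq_zero_of_not_pos (mt hk.1 hj), pow_zero]

/-- Only the finitely many values of `k` contribute, so the `finsum` is a true sum and not the
default value zero; injectivity of `c` makes the fibres disjoint. -/
lemma finsum_card_fiber {α β : Type*} [DecidableEq β] (k : Fin N → β) {c : α → β}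
    (hc : Function.Injective c) (P : α → Prop) :
    ∑ᶠ (i : α) (_ : P i), Finset.card {j : Fin N | k j = c i} =
      Nat.card {j : Fin N // ∃ i, P i ∧ k j = c i} := by
  classical
  let s : Finset α := (Finset.univ.image k).preimage c hc.injOn
  rw [finsum_eq_sum_of_support_subset (s := s)]
  · simp_rw [finsum_eq_if]
    rw [← Finset.sum_filter, ← Finset.card_biUnion]
    · rw [Nat.card_eq_fintype_card, Fintype.card_subtype]
      congr 1
      ext j
      simp only [Finset.mem_biUnion, Finset.mem_filter, Finset.mem_univ, true_and, s,
        Finset.mem_preimage, Finset.mem_image]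
      constructor
      · rintro ⟨i, ⟨-, hi⟩, h⟩
        exact ⟨i, hi, h⟩
      · rintro ⟨i, hi, h⟩
        exact ⟨i, ⟨⟨j, h⟩, hi⟩, h⟩
    · intro i _ i' _ hii
      rw [Function.onFun, Finset.disjoint_left]
      intro j hj hj'
      simp only [Finset.mem_filter, Finset.mem_univ, true_and] at hj hj'
      exact hii (hc (hj.symm.trans hj'))
  · intro i hi
    rw [Function.mem_support, finsum_eq_if] at hi
    simp only [ne_eq, ite_eq_right_iff, Classical.not_imp, Finset.card_eq_zero] at hi
    obtain ⟨j, hj⟩ := Finset.nonempty_iff_ne_empty.2 hi.2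
    simp only [Finset.mem_filter, Finset.mem_univ, true_and] at hj
    simp only [s, Finset.coe_preimage, Set.mem_preimage, Finset.coe_image, Finset.coe_univ,
      Set.image_univ, Set.mem_range]
    exact ⟨j, hj⟩

lemma sumPos_eq_posRank (N : ℕ) (Z : Matrix ℕ ℕ ℚ_[p]) :
    sumPos N Z = posRank (corner N Z) := by
  classical
  have h := finsum_card_fiber (sing (corner N Z)) (WithBot.coe_injective (α := ℤ))
    (fun i => 1 ≤ i)
  rw [posRank_eq_card, sumPos]
  refine Eq.trans ?_ (h.trans ?_)
  · simp only [ell]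
  · rw [Nat.card_eq_fintype_card, Fintype.card_subtype]
    congr 1
    ext j
    simp only [Finset.mem_filter, Finset.mem_univ, true_and]
    generalize sing (corner N Z) j = k
    induction k using WithBot.recBotCoe with
    | bot => simp
    | coe k => simp [Int.lt_iff_add_one_le]

lemma sumNonpos_eq_card (N : ℕ) (Z : Matrix ℕ ℕ ℚ_[p]) :
    sumNonpos N Z = (Finset.univ.filter fun j => ¬ 0 < sing (corner N Z) j).card := by
  classical
  have h := finsum_card_fiber (sing (corner N Z)) (Function.injective_id)
    (fun i : WithBot ℤ => i ≤ 0)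
  rw [sumNonpos]
  refine Eq.trans ?_ (h.trans ?_)
  · simp only [ell]
    rfl
  · rw [Nat.card_eq_fintype_card, Fintype.card_subtype]
    congr 1
    ext j
    simp

lemma sumPos_eq_sub (N : ℕ) (Z : Matrix ℕ ℕ ℚ_[p]) :
    (sumPos N Z : ℤ) = (N : ℤ) - (sumNonpos N Z : ℤ) := by
  rw [sumPos_eq_posRank, posRank_eq_card, sumNonpos_eq_card]
  have := Finset.card_filter_add_card_filter_not (s := (Finset.univ : Finset (Fin N)))
    (fun j => 0 < sing (corner N Z) j)
  rw [Finset.card_univ, Fintype.card_fin] at this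
  omega

end singular

/-! ### Consistency of the finite Hua measures and the infinite Hua measure. -/

section hua

variable {s : ℝ}

/-- The normalizing constant of the Hua measure. -/
def huaConst (p : ℕ) (s : ℝ) (N : ℕ) : ℝ :=
  qPoch ((p : ℝ) ^ (-1 - s)) (p : ℝ)⁻¹ N ^ 2 / qPoch ((p : ℝ) ^ (-1 - s)) (p : ℝ)⁻¹ (2 * N)

lemma rpow_neg_one_sub_lt_one (hs : -1 < s) : (p : ℝ) ^ (-1 - s) < 1 :=
  Real.rpow_lt_one_of_one_lt_of_neg one_lt_p (by linarith)

lemma mul_pow_lt_one {a q : ℝ} (ha : 0 ≤ a) (ha1 : a < 1) (hq : 0 ≤ q) (hq1 : q ≤ 1) (j : ℕ) :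
    a * q ^ j < 1 :=
  (mul_le_of_le_one_right ha (pow_le_one₀ hq hq1)).trans_lt ha1

lemma qPoch_pos {a q : ℝ} (ha : 0 ≤ a) (ha1 : a < 1) (hq : 0 ≤ q) (hq1 : q ≤ 1) (n : ℕ) :
    0 < qPoch a q n :=
  Finset.prod_pos fun j _ => sub_pos.2 (mul_pow_lt_one ha ha1 hq hq1 j)

lemma qPoch_succ (a q : ℝ) (n : ℕ) : qPoch a q (n + 1) = qPoch a q n * (1 - a * q ^ n) :=
  Finset.prod_range_succ _ _

lemma inv_p_nonneg : (0 : ℝ) ≤ (p : ℝ)⁻¹ := inv_nonneg.2 p_pos.le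

lemma inv_p_lt_one : (p : ℝ)⁻¹ < 1 := inv_lt_one_of_one_lt₀ one_lt_p

lemma huaConst_nonneg (hs : -1 < s) (N : ℕ) : 0 ≤ huaConst p s N :=
  div_nonneg (sq_nonneg _) (qPoch_pos (Real.rpow_nonneg p_pos.le _) (rpow_neg_one_sub_lt_one hs)
    inv_p_nonneg inv_p_lt_one.le _).le

lemma rpow_eq_mul_inv_pow (k : ℕ) :
    (p : ℝ) ^ (-1 - s - k) = (p : ℝ) ^ (-1 - s) * (p : ℝ)⁻¹ ^ k := by
  rw [Real.rpow_sub p_pos, Real.rpow_natCast, inv_pow, div_eq_mul_inv]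

/-- With `a = p ^ (-1 - s)` and `q = p⁻¹`, both denominators equal `1 - a q ^ N` and cancel the
growth of the squared symbol; the numerators `1 - a q ^ (2N+1)` and `1 - a q ^ (2N)` cancel that of
the symbol of length `2N`. -/
lemma huaConst_succ (hs : -1 < s) (N : ℕ) :
    huaConst p s (N + 1) * (stepTotal p (N + 1) ((p : ℝ) ^ (-(s + 2 * ((N + 1 : ℕ) : ℝ)))) *
      stepTotal p N ((p : ℝ) ^ (1 - (s + 2 * ((N + 1 : ℕ) : ℝ))))) = huaConst p s N := by
  have e1 : (p : ℝ) ^ (-(s + 2 * ((N + 1 : ℕ) : ℝ))) =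
      (p : ℝ) ^ (-1 - s) * (p : ℝ)⁻¹ ^ (2 * N + 1) := by
    rw [← rpow_eq_mul_inv_pow (p := p) (s := s)]; congr 1; push_cast; ring
  have e2 : (p : ℝ) ^ (1 - (s + 2 * ((N + 1 : ℕ) : ℝ))) =
      (p : ℝ) ^ (-1 - s) * (p : ℝ)⁻¹ ^ (2 * N) := by
    rw [← rpow_eq_mul_inv_pow (p := p) (s := s)]; congr 1; push_cast; ring
  have hlt := mul_pow_lt_one (Real.rpow_nonneg p_pos.le _) (rpow_neg_one_sub_lt_one (p := p) hs)
    (inv_p_nonneg (p := p)) inv_p_lt_one.le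
  have hq := qPoch_pos (Real.rpow_nonneg p_pos.le _) (rpow_neg_one_sub_lt_one (p := p) hs)
    (inv_p_nonneg (p := p)) inv_p_lt_one.le
  rw [e1, e2, huaConst, huaConst, stepTotal, stepTotal, show 2 * (N + 1) = 2 * N + 1 + 1 by ring]
  simp only [qPoch_succ]
  have hp0 : (p : ℝ) ≠ 0 := p_pos.ne'
  have f1 : (p : ℝ) ^ (N + 1) * ((p : ℝ) ^ (-1 - s) * (p : ℝ)⁻¹ ^ (2 * N + 1)) =
      (p : ℝ) ^ (-1 - s) * (p : ℝ)⁻¹ ^ N := by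
    rw [show 2 * N + 1 = (N + 1) + N by ring, pow_add (p : ℝ)⁻¹, inv_pow, inv_pow]
    field_simp
  have f2 : (p : ℝ) ^ N * ((p : ℝ) ^ (-1 - s) * (p : ℝ)⁻¹ ^ (2 * N)) =
      (p : ℝ) ^ (-1 - s) * (p : ℝ)⁻¹ ^ N := by
    rw [show 2 * N = N + N by ring, pow_add (p : ℝ)⁻¹, inv_pow]
    field_simp
  rw [f1, f2]
  generalize (p : ℝ) ^ (-1 - s) = a at hlt hq ⊢
  have g1 := (sub_pos.2 (hlt N)).ne'
  have g2 := (sub_pos.2 (hlt (2 * N))).ne'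
  have g3 := (sub_pos.2 (hlt (2 * N + 1))).ne'
  have g4 := (hq (2 * N)).ne'
  generalize 1 - a * (p : ℝ)⁻¹ ^ N = x at g1 ⊢
  generalize 1 - a * (p : ℝ)⁻¹ ^ (2 * N) = y at g2 ⊢
  generalize 1 - a * (p : ℝ)⁻¹ ^ (2 * N + 1) = z at g3 ⊢
  generalize qPoch a (p : ℝ)⁻¹ (2 * N) = w at g4 ⊢
  field_simp

lemma huaFin_eq (N : ℕ) : huaFin p s N = (volRect p N N).withDensity fun Z =>
    ENNReal.ofReal (huaConst p s N * latVol Z ^ (-s - 2 * (N : ℝ))) := by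
  simp_rw [huaFin, gam_eq_latVol]
  rfl

lemma lintegral_huaFin (hs : -1 < s) (N : ℕ) {g : Matrix (Fin N) (Fin N) ℚ_[p] → ℝ≥0∞}
    (hg : Measurable g) :
    ∫⁻ Z, g Z ∂huaFin p s N = ENNReal.ofReal (huaConst p s N) *
      ∫⁻ Z, g Z * ENNReal.ofReal (latVol Z ^ (-s - 2 * (N : ℝ))) ∂volRect p N N := by
  have hm := measurable_latVol_rpow (p := p) (n := N) (m := N) (-s - 2 * (N : ℝ))
  rw [huaFin_eq]
  simp_rw [ENNReal.ofReal_mul (huaConst_nonneg hs N)]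
  have hm2 : Measurable fun Z => g Z * ENNReal.ofReal (latVol Z ^ (-s - 2 * (N : ℝ))) :=
    hg.mul hm
  rw [lintegral_withDensity_eq_lintegral_mul _ (hm.const_mul _) hg, ← lintegral_const_mul _ hm2]
  refine lintegral_congr fun Z => ?_
  simp only [Pi.mul_apply]
  ring

lemma measurable_dropLast {n m : ℕ} :
    Measurable (dropLast : Matrix (Fin (n + 1)) (Fin (m + 1)) ℚ_[p] → _) :=
  measurable_submatrix _ _

lemma map_dropLast_huaFin (hs : -1 < s) (N : ℕ) :
    (huaFin p s (N + 1)).map dropLast = huaFin p s N := by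
  ext A hA
  have hd := measurable_dropLast (p := p) (n := N) (m := N)
  have hg : Measurable (A.indicator (1 : Matrix (Fin N) (Fin N) ℚ_[p] → ℝ≥0∞)) :=
    measurable_one.indicator hA
  rw [← lintegral_indicator_one hA, ← lintegral_indicator_one hA, lintegral_map hg hd,
    lintegral_huaFin hs _ (g := fun Z => A.indicator 1 (dropLast Z)) (hg.comp hd),
    lintegral_huaFin hs _ hg]
  have ht : (N : ℝ) + 1 < s + 2 * ((N + 1 : ℕ) : ℝ) := by
    push_cast
    have : (0 : ℝ) ≤ N := Nat.cast_nonneg N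
    linarith
  have h := lintegral_dropLast ht ht hg
  rw [show -s - 2 * ((N + 1 : ℕ) : ℝ) = -(s + 2 * ((N + 1 : ℕ) : ℝ)) by ring, h, ← mul_assoc,
    ← ENNReal.ofReal_mul (huaConst_nonneg hs _), huaConst_succ hs,
    show 2 - (s + 2 * ((N + 1 : ℕ) : ℝ)) = -s - 2 * (N : ℝ) by push_cast; ring]

/-- Consistency preserves total mass, so the normalization follows from the trivial case of size
zero. -/
lemma isProbabilityMeasure_huaFin (hs : -1 < s) (N : ℕ) : IsProbabilityMeasure (huaFin p s N) := by
  induction N with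
  | zero =>
    constructor
    rw [← lintegral_one, lintegral_huaFin hs 0 measurable_const]
    have h1 (Z : Matrix (Fin 0) (Fin 0) ℚ_[p]) : latVol Z = 1 := by
      rw [← gam_eq_latVol]; simp [gam]
    have h2 : volRect p 0 0 Set.univ = 1 := by
      rw [← volRect_integral (p := p) (n := 0) (m := 0)]
      congr 1
      ext Z
      simp
    simp [h1, h2, huaConst, qPoch]
  | succ N ih =>
    constructor
    have h := map_dropLast_huaFin (p := p) hs N
    rw [← Set.preimage_univ (f := dropLast), ← Measure.map_apply measurable_dropLast
      MeasurableSet.univ, h]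
    exact ih.measure_univ

lemma measurable_corner (N : ℕ) :
    Measurable (corner N : Matrix ℕ ℕ ℚ_[p] → Matrix (Fin N) (Fin N) ℚ_[p]) :=
  measurable_submatrix _ _

instance standardBorelSpace_matrix (N : ℕ) : StandardBorelSpace (Matrix (Fin N) (Fin N) ℚ_[p]) :=
  inferInstanceAs (StandardBorelSpace (Fin N → Fin N → ℚ_[p]))

/-- Assemble an infinite matrix from a sequence of corners. -/
def assemble (x : ∀ k, Matrix (Fin k) (Fin k) ℚ_[p]) : Matrix ℕ ℕ ℚ_[p] :=
  Matrix.of fun i j => x (max i j + 1) ⟨i, by omega⟩ ⟨j, by omega⟩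

lemma measurable_assemble : Measurable (assemble (p := p)) :=
  measurable_pi_lambda _ fun i => measurable_pi_lambda _ fun j =>
    (measurable_pi_apply (⟨j, by omega⟩ : Fin (max i j + 1))).comp
      ((measurable_pi_apply (⟨i, by omega⟩ : Fin (max i j + 1))).comp
        (measurable_pi_apply (max i j + 1)))

lemma corner_assemble {x : ∀ k, Matrix (Fin k) (Fin k) ℚ_[p]}
    (hx : ∀ k, dropLast (x (k + 1)) = x k) (N : ℕ) : corner N (assemble x) = x N := by
  have key (i j K : ℕ) (hK : max i j + 1 ≤ K) :
      x K ⟨i, by omega⟩ ⟨j, by omega⟩ = assemble x i j := by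
    induction K, hK using Nat.le_induction with
    | base => rfl
    | succ K hK ih =>
      rw [← ih, ← hx K]
      rfl
  ext i j
  exact (key i j N (by omega)).symm

theorem exists_isHuaMeasure (hs : -1 < s) : ∃ M, IsHuaMeasure p s M := by
  have := fun k => isProbabilityMeasure_huaFin (p := p) hs k
  obtain ⟨P, hP, h1, h2⟩ := exists_compatible_measure
    (E := fun k => Matrix (Fin k) (Fin k) ℚ_[p]) (fun _ => dropLast)
    (fun _ => measurable_dropLast) (fun k => huaFin p s k) (map_dropLast_huaFin hs)
  refine ⟨P.map assemble, Measure.isProbabilityMeasure_map measurable_assemble.aemeasurable,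
    fun N _ => ?_⟩
  rw [Measure.map_map (measurable_corner N) measurable_assemble, ← h1 N]
  refine Measure.map_congr ?_
  filter_upwards [ae_all_iff.2 h2] with x hx
  exact corner_assemble hx N

/-- Cylinder sets over corners of size at least one form a generating π-system: two corners are both
contained in the larger one. -/
theorem isHuaMeasure_unique {M M' : Measure (Matrix ℕ ℕ ℚ_[p])} (h : IsHuaMeasure p s M)
    (h' : IsHuaMeasure p s M') : M = M' := by
  have := h.isProbabilityMeasure
  have := h'.isProbabilityMeasure
  let 𝒞 : Set (Set (Matrix ℕ ℕ ℚ_[p])) :=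
    {A | ∃ (N : ℕ) (B : Set (Matrix (Fin (N + 1)) (Fin (N + 1)) ℚ_[p])),
      MeasurableSet B ∧ A = corner (N + 1) ⁻¹' B}
  have hgen : (inferInstance : MeasurableSpace (Matrix ℕ ℕ ℚ_[p])) =
      MeasurableSpace.generateFrom 𝒞 := by
    apply le_antisymm
    · have : @Measurable _ _ (MeasurableSpace.generateFrom 𝒞) MeasurableSpace.pi
          (fun Z : ℕ → ℕ → ℚ_[p] => Z) := by
        refine @measurable_pi_lambda _ _ _ (MeasurableSpace.generateFrom 𝒞) _ _ fun i =>
          @measurable_pi_lambda _ _ _ (MeasurableSpace.generateFrom 𝒞) _ _ fun j => ?_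
        intro t ht
        apply MeasurableSpace.measurableSet_generateFrom
        refine ⟨max i j, {W | W ⟨i, by omega⟩ ⟨j, by omega⟩ ∈ t}, ?_, rfl⟩
        exact ((measurable_pi_apply (⟨j, by omega⟩ : Fin (max i j + 1))).comp
          (measurable_pi_apply (⟨i, by omega⟩ : Fin (max i j + 1)))) ht
      exact fun t ht => this ht
    · refine MeasurableSpace.generateFrom_le ?_
      rintro _ ⟨N, B, hB, rfl⟩
      exact measurable_corner _ hB
  have hpi : IsPiSystem 𝒞 := by
    rintro _ ⟨N, B, hB, rfl⟩ _ ⟨N', B', hB', rfl⟩ _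
    refine ⟨max N N', (fun W => W.submatrix (Fin.castLE (by omega)) (Fin.castLE (by omega))) ⁻¹' B ∩
      (fun W => W.submatrix (Fin.castLE (by omega)) (Fin.castLE (by omega))) ⁻¹' B', ?_, rfl⟩
    exact (measurable_submatrix _ _ hB).inter (measurable_submatrix _ _ hB')
  refine ext_of_generate_finite 𝒞 hgen hpi ?_ (by simp)
  rintro _ ⟨N, B, hB, rfl⟩
  rw [← Measure.map_apply (measurable_corner _) hB, ← Measure.map_apply (measurable_corner _) hB,
    h.map_corner _ (by omega), h'.map_corner _ (by omega)]

lemma isHuaMeasure_hua (hs : -1 < s) : IsHuaMeasure p s (hua p s) :=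
  Classical.epsilon_spec (exists_isHuaMeasure hs)

end hua

end

/-! ### The law of the rank for finite matrices. -/

section

variable {p : ℕ} [hp : Fact p.Prime] {s : ℝ}

section algebra

/-- The product `∏_{i < j} (1 - q ^ (m - i))`, which vanishes for `j > m`. -/
def qFalling (q : ℝ) (m j : ℕ) : ℝ := ∏ i ∈ Finset.range j, (1 - q ^ (m - i))

lemma qFalling_eq_zero (q : ℝ) {m j : ℕ} (h : m < j) : qFalling q m j = 0 :=
  Finset.prod_eq_zero (Finset.mem_range.2 h) (by simp)

lemma qFalling_succ_right (q : ℝ) (m j : ℕ) :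
    qFalling q m (j + 1) = qFalling q m j * (1 - q ^ (m - j)) := Finset.prod_range_succ _ _

lemma qFalling_succ_succ (q : ℝ) (m j : ℕ) :
    qFalling q (m + 1) (j + 1) = (1 - q ^ (m + 1)) * qFalling q m j := by
  rw [qFalling, Finset.prod_range_succ', mul_comm, qFalling]
  simp

lemma qFalling_nonneg {q : ℝ} (hq : 0 ≤ q) (hq1 : q ≤ 1) (m j : ℕ) : 0 ≤ qFalling q m j :=
  Finset.prod_nonneg fun _ _ => sub_nonneg.2 (pow_le_one₀ hq hq1)

lemma qFalling_le_one {q : ℝ} (hq : 0 ≤ q) (hq1 : q ≤ 1) (m j : ℕ) : qFalling q m j ≤ 1 :=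
  Finset.prod_le_one (fun _ _ => sub_nonneg.2 (pow_le_one₀ hq hq1))
    fun _ _ => sub_le_self _ (pow_nonneg hq _)

lemma tendsto_qFalling {q : ℝ} (hq : 0 ≤ q) (hq1 : q < 1) (j : ℕ) :
    Tendsto (fun m => qFalling q m j) atTop (𝓝 1) := by
  have : Tendsto (fun m => ∏ i ∈ Finset.range j, (1 - q ^ (m - i))) atTop
      (𝓝 (∏ i ∈ Finset.range j, (1 - 0 : ℝ))) :=
    tendsto_finsetProd _ fun i _ => tendsto_const_nhds.sub
      ((tendsto_pow_atTop_nhds_zero_of_lt_one hq hq1).comp (tendsto_sub_atTop_nat i))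
  simpa [qFalling] using this

/-- The mass of the `n × m` matrices with `j` positive singular numbers, for the density
`γ ^ (-s - n - m)` with `a = p ^ (-1 - s)` and `q = p⁻¹`. -/
def rankMass (a q : ℝ) (n m j : ℕ) : ℝ :=
  a ^ j * q ^ (j * (j - 1)) * qFalling q n j * qFalling q m j / (qPoch q q j * qPoch a q j)

lemma rankMass_nonneg {a q : ℝ} (ha : 0 ≤ a) (ha1 : a < 1) (hq : 0 ≤ q) (hq1 : q < 1)
    (n m j : ℕ) : 0 ≤ rankMass a q n m j := by
  have h1 := qFalling_nonneg hq hq1.le n j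
  have h2 := qFalling_nonneg hq hq1.le m j
  have h3 := qPoch_pos ha ha1 hq hq1.le j
  have h4 := qPoch_pos hq hq1 hq hq1.le j
  unfold rankMass
  positivity

lemma rankMass_zero_right (a q : ℝ) (n m : ℕ) : rankMass a q n m 0 = 1 := by
  simp [rankMass, qFalling, qPoch]

lemma rankMass_zero_succ (a q : ℝ) (m j : ℕ) : rankMass a q 0 m (j + 1) = 0 := by
  simp [rankMass, qFalling_eq_zero q (Nat.succ_pos j)]

/-- The recursion satisfied by the rank masses when one row is added. -/
lemma rankMass_succ_succ {a q : ℝ} (ha : 0 < a) (ha1 : a < 1) (hq : 0 < q) (hq1 : q < 1)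
    (n j k : ℕ) :
    rankMass a q (n + 1) (j + k) (j + 1) * (1 - a * q ^ n) =
      (1 - a * q ^ (n + j + 1)) * rankMass a q n (j + k) (j + 1) +
        a * q ^ (n + j) * (1 - q ^ k) * rankMass a q n (j + k) j := by
  have hb : (1 - q * q ^ j) ≠ 0 := (sub_pos.2 (mul_pow_lt_one hq.le hq1 hq.le hq1.le j)).ne'
  have hc : (1 - a * q ^ j) ≠ 0 := (sub_pos.2 (mul_pow_lt_one ha.le ha1 hq.le hq1.le j)).ne'
  have h3 := (qPoch_pos ha.le ha1 hq.le hq1.le j).ne'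
  have h4 := (qPoch_pos hq.le hq1 hq.le hq1.le j).ne'
  have he : q ^ ((j + 1) * (j + 1 - 1)) = q ^ (j * (j - 1)) * q ^ j * q ^ j := by
    rw [← pow_add, ← pow_add]
    congr 1
    cases j with
    | zero => rfl
    | succ j => simp only [Nat.add_sub_cancel]; ring
  simp only [rankMass, qFalling_succ_succ, qFalling_succ_right _ n j,
    qFalling_succ_right _ (j + k) j, qPoch_succ, he, Nat.add_sub_cancel_left]
  rcases lt_or_ge n j with hnj | hnj
  · simp [qFalling_eq_zero q hnj]
  obtain ⟨l, rfl⟩ := Nat.exists_eq_add_of_le hnj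
  rw [Nat.add_sub_cancel_left]
  generalize qFalling q (j + l) j = A
  generalize qFalling q (j + k) j = B
  generalize qPoch a q j = C at h3 ⊢
  generalize qPoch q q j = D at h4 ⊢
  generalize q ^ (j * (j - 1)) = E
  rw [show q ^ (j + l + 1) = q ^ j * q ^ l * q by ring, show q ^ (j + l) = q ^ j * q ^ l by ring,
    show q ^ (j + l + j + 1) = q ^ j * q ^ l * q ^ j * q by ring,
    show q ^ (j + l + j) = q ^ j * q ^ l * q ^ j by ring, pow_succ a j]
  generalize a ^ j = F
  generalize q ^ j = J at hb hc ⊢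
  generalize q ^ l = L
  generalize q ^ k = K
  -- The two denominators are kept as atoms while clearing fractions and are expanded only for the
  -- final polynomial identity.
  obtain ⟨u, hu⟩ : ∃ u, u = 1 - q * J := ⟨_, rfl⟩
  obtain ⟨v, hv⟩ : ∃ v, v = 1 - a * J := ⟨_, rfl⟩
  rw [← hu] at hb ⊢
  rw [← hv] at hc ⊢
  field_simp
  rw [hu, hv]
  ring

end algebra

section rankLaw

lemma stepStay_eq {n m j : ℕ} (hj : j ≤ m) :
    stepStay p m j ((p : ℝ) ^ (-1 - s) * (p : ℝ)⁻¹ ^ (n + m)) =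
      (1 - (p : ℝ) ^ (-1 - s) * (p : ℝ)⁻¹ ^ (n + j)) / (1 - (p : ℝ) ^ (-1 - s) * (p : ℝ)⁻¹ ^ n) := by
  have hp0 : (p : ℝ) ≠ 0 := p_pos.ne'
  obtain ⟨k, rfl⟩ := Nat.exists_eq_add_of_le hj
  rw [stepStay, Nat.add_sub_cancel_left]
  generalize (p : ℝ) ^ (-1 - s) = a
  congr 2
  · rw [← add_assoc n, pow_add _ (n + j) k, inv_pow _ k]
    field_simp
  · rw [pow_add _ n, inv_pow _ (j + k)]
    field_simp

lemma stepUp_eq {n m j : ℕ} (hj : j ≤ m) :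
    stepUp p m j ((p : ℝ) ^ (-1 - s) * (p : ℝ)⁻¹ ^ (n + m)) =
      (p : ℝ) ^ (-1 - s) * (p : ℝ)⁻¹ ^ (n + j) * (1 - (p : ℝ)⁻¹ ^ (m - j)) /
        (1 - (p : ℝ) ^ (-1 - s) * (p : ℝ)⁻¹ ^ n) := by
  have hp0 : (p : ℝ) ≠ 0 := p_pos.ne'
  obtain ⟨k, rfl⟩ := Nat.exists_eq_add_of_le hj
  rw [stepUp, Nat.add_sub_cancel_left]
  generalize (p : ℝ) ^ (-1 - s) = a
  congr 1
  · rw [← add_assoc n, pow_add _ (n + j) k, inv_pow _ k]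
    field_simp
  · congr 1
    rw [pow_add _ n, inv_pow _ (j + k)]
    field_simp

lemma rankMass_recursion (hs : -1 < s) (n m j : ℕ) :
    rankMass ((p : ℝ) ^ (-1 - s)) (p : ℝ)⁻¹ (n + 1) m (j + 1) =
      stepStay p m (j + 1) ((p : ℝ) ^ (-1 - s) * (p : ℝ)⁻¹ ^ (n + m)) *
        rankMass ((p : ℝ) ^ (-1 - s)) (p : ℝ)⁻¹ n m (j + 1) +
      stepUp p m j ((p : ℝ) ^ (-1 - s) * (p : ℝ)⁻¹ ^ (n + m)) *
        rankMass ((p : ℝ) ^ (-1 - s)) (p : ℝ)⁻¹ n m j := by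
  have hq := inv_pos.2 (p_pos (p := p))
  have hq1 := inv_p_lt_one (p := p)
  have ha := Real.rpow_pos_of_pos (p_pos (p := p)) (-1 - s)
  have ha1 := rpow_neg_one_sub_lt_one (p := p) hs
  have hne := (sub_pos.2 (mul_pow_lt_one ha.le ha1 hq.le hq1.le n)).ne'
  rcases lt_or_ge m j with hmj | hmj
  · simp [rankMass, qFalling_eq_zero _ hmj, qFalling_eq_zero _ (hmj.trans (Nat.lt_succ_self j))]
  have h := rankMass_succ_succ ha ha1 hq hq1 n j (m - j)
  rw [Nat.add_sub_cancel' hmj] at h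
  rw [stepUp_eq hmj]
  -- At `j = m` the truncated exponent makes the stay factor meaningless for `j + 1`, but it
  -- multiplies a vanishing mass, and the up factor is zero.
  rcases hmj.eq_or_lt with rfl | hlt
  · simp [rankMass, qFalling_eq_zero _ (Nat.lt_succ_self j)]
  · rw [stepStay_eq hlt, div_mul_eq_mul_div, div_mul_eq_mul_div, ← add_div, eq_div_iff hne, h]
    rfl

lemma latVol_zero_rows {m : ℕ} (Z : Matrix (Fin 0) (Fin m) ℚ_[p]) : latVol Z = 1 := by
  have h : SmithEquiv Z (rdiag 0 m 0) := by
    convert SmithEquiv.refl Z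
    ext i
    exact i.elim0
  rw [latVol_of_smith h]
  simp

lemma posRank_zero_rows {m : ℕ} (Z : Matrix (Fin 0) (Fin m) ℚ_[p]) : posRank Z = 0 :=
  posRank_eq_of_latVol (by simp [latVol_zero_rows])

lemma volRect_zero_univ (m : ℕ) : volRect p 0 m Set.univ = 1 := by
  rw [← volRect_integral (p := p) (n := 0) (m := m)]
  congr 1
  ext Z
  simp

/-- The mass of the matrices with `j` positive singular numbers. -/
theorem lintegral_posRank (hs : -1 < s) (n m j : ℕ) :
    ∫⁻ Z, (if posRank Z = j then 1 else 0) * ENNReal.ofReal (latVol Z ^ (-(s + n + m)))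
        ∂volRect p n m =
      ENNReal.ofReal (rankMass ((p : ℝ) ^ (-1 - s)) (p : ℝ)⁻¹ n m j) := by
  have hmeas (n : ℕ) (j : ℕ) (t : ℝ) : Measurable fun Z : Matrix (Fin n) (Fin m) ℚ_[p] =>
      (if posRank Z = j then 1 else 0 : ℝ≥0∞) * ENNReal.ofReal (latVol Z ^ t) :=
    (Measurable.ite (measurable_posRank (measurableSet_singleton j)) measurable_const
      measurable_const).mul (measurable_latVol_rpow t)
  have hq := inv_pos.2 (p_pos (p := p))
  have hq1 := inv_p_lt_one (p := p)
  have ha := Real.rpow_pos_of_pos (p_pos (p := p)) (-1 - s)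
  have ha1 := rpow_neg_one_sub_lt_one (p := p) hs
  induction n generalizing j with
  | zero =>
    simp only [latVol_zero_rows, posRank_zero_rows, Real.one_rpow, ENNReal.ofReal_one, mul_one,
      lintegral_const, volRect_zero_univ]
    cases j with
    | zero => simp [rankMass_zero_right]
    | succ j => simp [rankMass_zero_succ]
  | succ n ih =>
    set t : ℝ := s + ((n + 1 : ℕ) : ℝ) + m with ht
    have hmt : (m : ℝ) < t := by
      rw [ht]; push_cast
      have : (0 : ℝ) ≤ n := Nat.cast_nonneg n
      linarith
    have hx : (p : ℝ) ^ (-t) = (p : ℝ) ^ (-1 - s) * (p : ℝ)⁻¹ ^ (n + m) := by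
      rw [← rpow_eq_mul_inv_pow]; congr 1; rw [ht]; push_cast; ring
    have h1t : 1 - t = -(s + n + m) := by rw [ht]; push_cast; ring
    rw [lintegral_volRect_succ (Fin.last n) (hmeas _ _ _)]
    simp_rw [fun Z : Matrix (Fin n) (Fin m) ℚ_[p] => lintegral_insRow (Fin.last n) Z hmt
      (fun r => if r = j then 1 else 0)]
    rw [h1t]
    cases j with
    | zero =>
      have h1 (Z : Matrix (Fin n) (Fin m) ℚ_[p]) :
          ENNReal.ofReal (latVol Z ^ (-(s + n + m))) *
            ((if posRank Z = 0 then 1 else 0) *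
                ENNReal.ofReal (stepStay p m (posRank Z) ((p : ℝ) ^ (-t))) +
              (if posRank Z + 1 = 0 then 1 else 0) *
                ENNReal.ofReal (stepUp p m (posRank Z) ((p : ℝ) ^ (-t)))) =
          (if posRank Z = 0 then 1 else 0) * ENNReal.ofReal (latVol Z ^ (-(s + n + m))) := by
        by_cases hr : posRank Z = 0
        -- Rank zero can only come from rank zero, with factor one, which is why the class `j = 0`
        -- keeps mass one.
        · have : stepStay p m 0 ((p : ℝ) ^ (-t)) = 1 := by
            have := pow_mul_rpow_lt_one (p := p) hmt
            rw [stepStay, Nat.sub_zero, div_self (by linarith)]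
          simp [hr, this]
        · simp [hr]
      simp_rw [h1]
      rw [ih, rankMass_zero_right, rankMass_zero_right]
    | succ j =>
      have h1 (Z : Matrix (Fin n) (Fin m) ℚ_[p]) :
          ENNReal.ofReal (latVol Z ^ (-(s + n + m))) *
            ((if posRank Z = j + 1 then 1 else 0) *
                ENNReal.ofReal (stepStay p m (posRank Z) ((p : ℝ) ^ (-t))) +
              (if posRank Z + 1 = j + 1 then 1 else 0) *
                ENNReal.ofReal (stepUp p m (posRank Z) ((p : ℝ) ^ (-t)))) =
          ENNReal.ofReal (stepStay p m (j + 1) ((p : ℝ) ^ (-t))) *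
            ((if posRank Z = j + 1 then 1 else 0) *
              ENNReal.ofReal (latVol Z ^ (-(s + n + m)))) +
          ENNReal.ofReal (stepUp p m j ((p : ℝ) ^ (-t))) *
            ((if posRank Z = j then 1 else 0) *
              ENNReal.ofReal (latVol Z ^ (-(s + n + m)))) := by
        by_cases hr : posRank Z = j + 1
        · simp [hr, mul_comm]
        · by_cases hr' : posRank Z = j
          · simp [hr', mul_comm]
          · simp [hr, hr']
      simp_rw [h1]
      have hnn := fun j => rankMass_nonneg ha.le ha1 hq.le hq1 n m j
      rw [lintegral_add_left ((hmeas _ _ _).const_mul _), lintegral_const_mul _ (hmeas _ _ _),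
        lintegral_const_mul _ (hmeas _ _ _), ih, ih, ← ENNReal.ofReal_mul (stepStay_nonneg _ hmt),
        ← ENNReal.ofReal_mul (stepUp_nonneg _ hmt), ← ENNReal.ofReal_add
        (mul_nonneg (stepStay_nonneg _ hmt) (hnn _)) (mul_nonneg (stepUp_nonneg _ hmt) (hnn _)),
        hx, ← rankMass_recursion hs]

lemma huaFin_posRank (hs : -1 < s) (N j : ℕ) :
    (huaFin p s N).map posRank {j} =
      ENNReal.ofReal (huaConst p s N *
        rankMass ((p : ℝ) ^ (-1 - s)) (p : ℝ)⁻¹ N N j) := by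
  have hmeas : MeasurableSet {Z : Matrix (Fin N) (Fin N) ℚ_[p] | posRank Z = j} :=
    measurable_posRank (measurableSet_singleton j)
  rw [Measure.map_apply measurable_posRank (measurableSet_singleton j),
    ENNReal.ofReal_mul (huaConst_nonneg hs N), ← lintegral_posRank hs]
  have h1 : ∫⁻ Z, (if posRank Z = j then 1 else 0 : ℝ≥0∞) ∂huaFin p s N =
      huaFin p s N (posRank ⁻¹' {j}) := by
    rw [← lintegral_indicator_one (measurable_posRank (measurableSet_singleton j))]
    refine lintegral_congr fun Z => ?_
    by_cases h : posRank Z = j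
    · rw [if_pos h, Set.indicator_of_mem (show Z ∈ posRank ⁻¹' {j} from h), Pi.one_apply]
    · rw [if_neg h, Set.indicator_of_notMem (show Z ∉ posRank ⁻¹' {j} from h)]
  rw [← h1, lintegral_huaFin hs _ (Measurable.ite hmeas measurable_const measurable_const)]
  congr! 6
  ring

end rankLaw

end

/-! ### The limit as the size grows. -/

section

variable {p : ℕ} [hp : Fact p.Prime] {s : ℝ}

section limits

variable {a q : ℝ}

lemma tendsto_qPoch (hq : 0 ≤ q) (hq1 : q < 1) :
    Tendsto (qPoch a q) atTop (𝓝 (qPochInf a q)) := by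
  have hs : Summable fun j : ℕ => -(a * q ^ j) :=
    ((summable_geometric_of_lt_one hq hq1).mul_left a).neg
  have := (Real.multipliable_one_add_of_summable hs).tendsto_prod_tprod_nat
  simp only [← sub_eq_add_neg] at this
  exact this

lemma qPochInf_pos (ha : 0 ≤ a) (ha1 : a < 1) (hq : 0 ≤ q) (hq1 : q < 1) : 0 < qPochInf a q := by
  have hs : Summable fun j : ℕ => -(a * q ^ j) :=
    ((summable_geometric_of_lt_one hq hq1).mul_left a).neg
  have hl := Real.summable_log_one_add_of_summable hs
  have := Real.rexp_tsum_eq_tprod (fun j => by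
    rw [← sub_eq_add_neg]
    exact sub_pos.2 (mul_pow_lt_one ha ha1 hq hq1.le j)) hl
  simp only [← sub_eq_add_neg] at this
  rw [qPochInf, ← this]
  exact Real.exp_pos _

lemma qPochInf_le (ha : 0 ≤ a) (ha1 : a < 1) (hq : 0 ≤ q) (hq1 : q < 1) (n : ℕ) :
    qPochInf a q ≤ qPoch a q n := by
  refine Antitone.le_of_tendsto (antitone_nat_of_succ_le fun n => ?_)
    (tendsto_qPoch hq hq1) n
  rw [qPoch_succ]
  exact mul_le_of_le_one_right (qPoch_pos ha ha1 hq hq1.le n).le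
    (sub_le_self _ (mul_nonneg ha (pow_nonneg hq _)))

end limits

/-- The probability that an `N × N` Hua matrix has `j` positive singular numbers. -/
def rankProb (p : ℕ) (s : ℝ) (N j : ℕ) : ℝ :=
  huaConst p s N * rankMass ((p : ℝ) ^ (-1 - s)) (p : ℝ)⁻¹ N N j

lemma rankProb_nonneg (hs : -1 < s) (N j : ℕ) : 0 ≤ rankProb p s N j :=
  mul_nonneg (huaConst_nonneg hs N) (rankMass_nonneg (Real.rpow_nonneg p_pos.le _)
    (rpow_neg_one_sub_lt_one hs) inv_p_nonneg inv_p_lt_one N N j)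

/-- The square of the infinite product is divided by the infinite product itself, which is nonzero.
-/
lemma tendsto_huaConst (hs : -1 < s) :
    Tendsto (huaConst p s) atTop (𝓝 (qPochInf ((p : ℝ) ^ (-1 - s)) (p : ℝ)⁻¹)) := by
  have h := tendsto_qPoch (a := (p : ℝ) ^ (-1 - s)) inv_p_nonneg (inv_p_lt_one (p := p))
  have h0 := qPochInf_pos (Real.rpow_nonneg (p_pos (p := p)).le (-1 - s))
    (rpow_neg_one_sub_lt_one hs) inv_p_nonneg (inv_p_lt_one (p := p))
  have h2 := h.comp (tendsto_id.const_mul_atTop' (zero_lt_two (α := ℕ)))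
  have := (h.pow 2).div h2 h0.ne'
  rw [pow_two, mul_div_assoc, div_self h0.ne', mul_one] at this
  exact this

lemma rpow_piWeight (x : ℕ) :
    (p : ℝ) ^ (-(x : ℝ) ^ 2 - s * x) =
      ((p : ℝ) ^ (-1 - s)) ^ x * (p : ℝ)⁻¹ ^ (x * (x - 1)) := by
  rw [inv_pow, ← Real.rpow_natCast (p : ℝ), ← Real.rpow_natCast _ x, ← Real.rpow_mul p_pos.le,
    ← Real.rpow_neg p_pos.le, ← Real.rpow_add p_pos]
  congr 1
  cases x with
  | zero => simp
  | succ x => push_cast [Nat.add_sub_cancel]; ring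

lemma tendsto_rankProb (hs : -1 < s) (j : ℕ) :
    Tendsto (fun N => rankProb p s N j) atTop (𝓝 (piWeight p s j)) := by
  have h1 := tendsto_qFalling inv_p_nonneg (inv_p_lt_one (p := p)) j
  have h2 := ((((tendsto_const_nhds (x := ((p : ℝ) ^ (-1 - s)) ^ j *
    (p : ℝ)⁻¹ ^ (j * (j - 1)))).mul h1).mul h1).div_const
    (qPoch (p : ℝ)⁻¹ (p : ℝ)⁻¹ j * qPoch ((p : ℝ) ^ (-1 - s)) (p : ℝ)⁻¹ j))
  have h3 := (tendsto_huaConst (p := p) hs).mul h2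
  rw [mul_one, mul_one, ← rpow_piWeight] at h3
  have e : piWeight p s j = qPochInf ((p : ℝ) ^ (-1 - s)) (p : ℝ)⁻¹ *
      ((p : ℝ) ^ (-(j : ℝ) ^ 2 - s * j) /
        (qPoch (p : ℝ)⁻¹ (p : ℝ)⁻¹ j * qPoch ((p : ℝ) ^ (-1 - s)) (p : ℝ)⁻¹ j)) := by
    rw [piWeight]; ring
  rw [e]
  refine h3.congr fun N => ?_
  rw [rankProb, rankMass, rpow_piWeight]

/-- The constants converge, hence are bounded. The falling products and the power of `q` are at most
one, and the denominators are bounded below by positive infinite products. -/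
lemma exists_rankProb_le (hs : -1 < s) :
    ∃ K : ℝ, ∀ N j, rankProb p s N j ≤ K * ((p : ℝ) ^ (-1 - s)) ^ j := by
  obtain ⟨K, hK⟩ := (tendsto_huaConst (p := p) hs).bddAbove_range
  have hq := inv_p_nonneg (p := p)
  have hq1 := inv_p_lt_one (p := p)
  have ha := Real.rpow_nonneg (p_pos (p := p)).le (-1 - s)
  have ha1 := rpow_neg_one_sub_lt_one (p := p) hs
  have hA := qPochInf_pos ha ha1 hq hq1
  have hQ := qPochInf_pos hq hq1 hq hq1
  refine ⟨K / (qPochInf (p : ℝ)⁻¹ (p : ℝ)⁻¹ * qPochInf ((p : ℝ) ^ (-1 - s)) (p : ℝ)⁻¹),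
    fun N j => ?_⟩
  have hK0 : huaConst p s N ≤ K := hK ⟨N, rfl⟩
  have hKn : 0 ≤ K := (huaConst_nonneg hs N).trans hK0
  have h1 : rankMass ((p : ℝ) ^ (-1 - s)) (p : ℝ)⁻¹ N N j ≤ ((p : ℝ) ^ (-1 - s)) ^ j /
      (qPochInf (p : ℝ)⁻¹ (p : ℝ)⁻¹ * qPochInf ((p : ℝ) ^ (-1 - s)) (p : ℝ)⁻¹) := by
    refine div_le_div₀ (pow_nonneg ha _) ?_ (mul_pos hQ hA)
      (mul_le_mul (qPochInf_le hq hq1 hq hq1 j) (qPochInf_le ha ha1 hq hq1 j) hA.le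
        (qPoch_pos hq hq1 hq hq1.le j).le)
    have hf := qFalling_le_one hq hq1.le N j
    have hf0 := qFalling_nonneg hq hq1.le N j
    have hb := pow_nonneg ha j
    have hc := pow_nonneg hq (j * (j - 1))
    refine (mul_le_of_le_one_right (by positivity) hf).trans ?_
    refine (mul_le_of_le_one_right (by positivity) hf).trans ?_
    exact mul_le_of_le_one_right hb (pow_le_one₀ hq hq1.le)
  calc rankProb p s N j ≤ K * _ := mul_le_mul hK0 h1
        (rankMass_nonneg ha ha1 hq hq1 N N j) hKn
    _ = _ := by ring

/-- Dominated convergence for expectations of bounded functions of the rank. -/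
lemma tendsto_tsum_rankProb (hs : -1 < s) (f : ℕ → ℝ) {c : ℝ} (hf : ∀ j, |f j| ≤ c) :
    Tendsto (fun N => ∑' j, rankProb p s N j * f j) atTop (𝓝 (∑' j, piWeight p s j * f j)) := by
  obtain ⟨K, hK⟩ := exists_rankProb_le (p := p) hs
  refine tendsto_tsum_of_dominated_convergence
    (bound := fun j => K * ((p : ℝ) ^ (-1 - s)) ^ j * c) ?_ ?_ ?_
  · exact ((summable_geometric_of_lt_one (Real.rpow_nonneg p_pos.le _)
      (rpow_neg_one_sub_lt_one hs)).mul_left K).mul_right c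
  · exact fun j => (tendsto_rankProb hs j).mul_const _
  · refine Eventually.of_forall fun N j => ?_
    rw [norm_mul, Real.norm_of_nonneg (rankProb_nonneg hs N j)]
    exact mul_le_mul (hK N j) (hf j) (norm_nonneg _) ((rankProb_nonneg hs N j).trans (hK N j))

lemma isProbabilityMeasure_map_posRank (hs : -1 < s) (N : ℕ) :
    IsProbabilityMeasure ((huaFin p s N).map posRank) :=
  have := isProbabilityMeasure_huaFin (p := p) hs N
  Measure.isProbabilityMeasure_map measurable_posRank.aemeasurable

lemma map_posRank_real_singleton (hs : -1 < s) (N j : ℕ) :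
    ((huaFin p s N).map posRank).real {j} = rankProb p s N j := by
  rw [Measure.real, huaFin_posRank hs, ← rankProb, ENNReal.toReal_ofReal (rankProb_nonneg hs N j)]

lemma integral_eq_tsum_nat (μ : Measure ℕ) [IsFiniteMeasure μ] (f : BoundedContinuousFunction ℕ ℝ) :
    ∫ j, f j ∂μ = ∑' j, μ.real {j} * f j :=
  integral_countable (f.integrable μ)

/-- The rank probabilities sum to one for each size, and dominated convergence with the test
function one passes this to the limit, in place of a `q`-series identity. -/
lemma hasSum_piWeight (hs : -1 < s) : HasSum (piWeight p s) 1 := by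
  have h := tendsto_tsum_rankProb (p := p) hs (fun _ => 1) (c := 1) (by simp)
  have h1 (N : ℕ) : ∑' j, rankProb p s N j * 1 = 1 := by
    have := isProbabilityMeasure_map_posRank (p := p) hs N
    have h2 := integral_eq_tsum_nat ((huaFin p s N).map posRank)
      (BoundedContinuousFunction.const ℕ (1 : ℝ))
    simp only [map_posRank_real_singleton hs, BoundedContinuousFunction.const_apply,
      integral_const, probReal_univ, smul_eq_mul] at h2
    rw [← h2, one_mul]
  simp_rw [h1] at h
  have h3 := tendsto_nhds_unique tendsto_const_nhds h
  simp_rw [mul_one] at h3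
  -- A divergent series would have `tsum` zero by convention, contradicting the value one.
  have hs : Summable (piWeight p s) := by
    by_contra hc
    rw [tsum_eq_zero_of_not_summable hc] at h3
    exact one_ne_zero h3
  rw [h3]
  exact hs.hasSum

lemma piWeight_nonneg (hs : -1 < s) (j : ℕ) : 0 ≤ piWeight p s j :=
  ge_of_tendsto' (tendsto_rankProb hs j) fun N => rankProb_nonneg hs N j

lemma piMeasure_singleton {p : ℕ} {s : ℝ} (j : ℕ) : piMeasure p s {j} = ENNReal.ofReal (piWeight p s j) := by
  rw [piMeasure, Measure.sum_apply _ (measurableSet_singleton j), tsum_eq_single j]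
  · simp
  · intro k hk
    simp [hk]

theorem isProbabilityMeasure_piMeasure (hs : -1 < s) : IsProbabilityMeasure (piMeasure p s) := by
  constructor
  rw [piMeasure, Measure.sum_apply _ MeasurableSet.univ]
  simp only [Measure.smul_apply, measure_univ, smul_eq_mul, mul_one]
  rw [← ENNReal.ofReal_tsum_of_nonneg (piWeight_nonneg hs) (hasSum_piWeight hs).summable,
    (hasSum_piWeight hs).tsum_eq, ENNReal.ofReal_one]

lemma measurable_sumPos (N : ℕ) : Measurable (sumPos N : Matrix ℕ ℕ ℚ_[p] → ℕ) := by
  have : (sumPos N : Matrix ℕ ℕ ℚ_[p] → ℕ) = posRank ∘ corner N :=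
    funext fun Z => sumPos_eq_posRank N Z
  rw [this]
  exact measurable_posRank.comp (measurable_corner N)

lemma map_sumPos_hua (hs : -1 < s) {N : ℕ} (hN : 1 ≤ N) :
    (hua p s).map (sumPos N) = (huaFin p s N).map posRank := by
  have : (sumPos N : Matrix ℕ ℕ ℚ_[p] → ℕ) = posRank ∘ corner N :=
    funext fun Z => sumPos_eq_posRank N Z
  rw [this, ← Measure.map_map measurable_posRank (measurable_corner N),
    (isHuaMeasure_hua hs).map_corner N hN]

theorem tendstoInDistribution_sumPos (hs : -1 < s) [IsProbabilityMeasure (piMeasure p s)]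
    {Ω : Type*} [MeasurableSpace Ω] (P : Measure Ω) [IsProbabilityMeasure P]
    (Z : Ω → Matrix ℕ ℕ ℚ_[p]) (hZ : HasLaw Z (hua p s) P) :
    TendstoInDistribution (fun (N : ℕ) (ω : Ω) => sumPos N (Z ω)) atTop
      (id : ℕ → ℕ) (fun _ => P) (piMeasure p s) where
  forall_aemeasurable N := (measurable_sumPos N).comp_aemeasurable hZ.aemeasurable
  aemeasurable_limit := aemeasurable_id
  tendsto := by
    refine ProbabilityMeasure.tendsto_iff_forall_integral_tendsto.2 fun f => ?_
    have hlim := tendsto_tsum_rankProb (p := p) hs f (c := ‖f‖) fun j => f.norm_coe_le_norm j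
    have h1 : ∫ j, f j ∂((piMeasure p s).map id) = ∑' j, piWeight p s j * f j := by
      rw [Measure.map_id, integral_eq_tsum_nat]
      refine tsum_congr fun j => ?_
      rw [Measure.real, piMeasure_singleton, ENNReal.toReal_ofReal (piWeight_nonneg hs j)]
    have h2 (N : ℕ) (hN : 1 ≤ N) : ∫ j, f j ∂(P.map fun ω => sumPos N (Z ω)) =
        ∑' j, rankProb p s N j * f j := by
      have h3 : (P.map fun ω => sumPos N (Z ω)) = (huaFin p s N).map posRank := by
        rw [← map_sumPos_hua hs hN, ← hZ.map_eq,
          AEMeasurable.map_map_of_aemeasurable (measurable_sumPos N).aemeasurable hZ.aemeasurable]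
        rfl
      have := isProbabilityMeasure_map_posRank (p := p) hs N
      rw [h3, integral_eq_tsum_nat]
      simp_rw [map_posRank_real_singleton hs]
    change Tendsto _ _ (𝓝 (∫ j, f j ∂((piMeasure p s).map id)))
    rw [h1]
    refine hlim.congr' ?_
    filter_upwards [eventually_ge_atTop 1] with N hN
    exact (h2 N hN).symm

end

end PadicHua

end

theorem lemma3p7 (p : ℕ) [Fact p.Prime] (s : ℝ) (hs : -1 < s) :
    (∃! M : Measure (Matrix ℕ ℕ ℚ_[p]), PadicHua.IsHuaMeasure p s M) ∧
    ∃ _ : IsProbabilityMeasure (PadicHua.piMeasure p s),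
      ∀ {Ω : Type*} [MeasurableSpace Ω] (P : Measure Ω) [IsProbabilityMeasure P]
        (Z : Ω → Matrix ℕ ℕ ℚ_[p]), HasLaw Z (PadicHua.hua p s) P →
        (∀ (N : ℕ) (ω : Ω), (PadicHua.sumPos N (Z ω) : ℤ) =
          (N : ℤ) - (PadicHua.sumNonpos N (Z ω) : ℤ)) ∧
        TendstoInDistribution (fun (N : ℕ) (ω : Ω) => PadicHua.sumPos N (Z ω)) atTop
          (id : ℕ → ℕ) (fun _ => P) (PadicHua.piMeasure p s) := by
  obtain ⟨M, hM⟩ := PadicHua.exists_isHuaMeasure (p := p) hs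
  have hπ := PadicHua.isProbabilityMeasure_piMeasure (p := p) hs
  exact ⟨⟨M, hM, fun M' hM' => PadicHua.isHuaMeasure_unique hM' hM⟩, hπ,
    fun P _ Z hZ => ⟨fun N ω => PadicHua.sumPos_eq_sub N (Z ω),
      PadicHua.tendstoInDistribution_sumPos hs P Z hZ⟩⟩
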